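/- All graphs are finite, simple and undirected; $|G|$ denotes the number of vertices of $G$. A \emph{tree embedding} of a graph $G$ is a partial order on $V(G)$ such that the set of elements below any given vertex is totally ordered and any two adjacent vertices of $G$ are comparable. Its depth is the maximum over all vertices $v$ of the number of vertices strictly smaller than $v$. The \emph{treedepth} of $G$ is the minimum depth of a tree embedding of $G$; a class $\mathcal C$ of graphs has \emph{bounded treedepth} if there is a constant $d$ such that every graph of $\mathcal C$ has treedepth at most $d$. A graph $G$ is \emph{$H$-free} if there is no injection $V(H)\to V(G)$ that maps edges of $H$ to edges of $G$. For $\varepsilon>0$, $G$ is \emph{$\varepsilon$-far} from being $H$-free if more than $\varepsilon|G|$ edges have to be deleted from or inserted to $G$ to obtain an $H$-free graph on the same vertex set. In the \emph{random neighbor model}, a randomized algorithm knows the vertex set of its input graph $G$ and accesses $G$ only by (adaptive) random neighbor queries: given a vertex $v$, the oracle returns a neighbor of $v$ in $G$, chosen independently and uniformly at random among all neighbors of $v$ (or reports that $v$ has no neighbor). \textbf{Theorem.} Let $H$ be a graph and $\mathcal C$ a class of graphs of bounded treedepth. For every $\varepsilon>0$ there are a constant $q$ (depending only on $H$, $\mathcal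 C$ and $\varepsilon$) and a randomized algorithm in the random neighbor model that, on every input graph $G\in\mathcal C$, always halts after at most $q$ queries and \begin{itemize} \item accepts $G$ with probability $1$ if $G$ is $H$-free; \item rejects $G$ with probability at least $2/3$ if $G$ is $\varepsilon$-far from being $H$-free. \end{itemize} That is, the property of being $H$-free can be tested in the random neighbor model on graphs of $\mathcal C$ with constant query complexity and one-sided error. -/

import Mathlib

open scoped ENNReal

namespace GraphTesting

/-! ### Treedepth -/

/-- A tree order on `V`: a partial order in which the elements below any given element
are totally ordered. -/
structure IsTreeOrder {V : Type*} (le : V → V → Prop) : Prop where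
  refl : ∀ v, le v v
  antisymm : ∀ u v, le u v → le v u → u = v
  trans : ∀ u v w, le u v → le v w → le u w
  total_below : ∀ u v w, le u w → le v w → le u v ∨ le v u

/-- The level of `v`: the number of elements strictly smaller than `v`. Roots have level zero. -/
noncomputable def level {V : Type*} (le : V → V → Prop) (v : V) : ℕ :=
  {u : V | le u v ∧ u ≠ v}.ncard

/-- The depth of a tree order: the maximal level of its vertices. -/
noncomputable def depth {V : Type*} [Fintype V] (le : V → V → Prop) : ℕ :=
  Finset.univ.sup (level le)

/-- A tree embedding of `G`: a tree order on the vertices of `G` for which any two adjacent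
vertices are comparable. -/
structure IsTreeEmbedding {V : Type*} (G : SimpleGraph V) (le : V → V → Prop) : Prop where
  isTreeOrder : IsTreeOrder le
  comparable : ∀ u v, G.Adj u v → le u v ∨ le v u

/-- The treedepth of a finite graph: the minimum depth of its tree embeddings. (The set is
nonempty, as every linear order on the vertices is a tree embedding.) -/
noncomputable def treedepth {V : Type*} [Fintype V] (G : SimpleGraph V) : ℕ :=
  sInf {k : ℕ | ∃ le : V → V → Prop, IsTreeEmbedding G le ∧ depth le = k}

/-! ### Graph classes and graph properties

Graphs are finite and simple, with vertex set `{0, …, n - 1}`. -/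

/-- A class of graphs, or a property of graphs: a set of graphs on `{0, …, n - 1}`
for every `n`. -/
abbrev GraphClass : Type := (n : ℕ) → Set (SimpleGraph (Fin n))

/-- The graphs of the class have treedepth at most some constant `d`. -/
def HasBoundedTreedepth (C : GraphClass) : Prop :=
  ∃ d : ℕ, ∀ (n : ℕ) (G : SimpleGraph (Fin n)), G ∈ C n → treedepth G ≤ d

/-- The property of being `H`-free: there is no copy of `H` in the graph, i.e. no injection of
the vertices of `H` into those of the graph that maps edges to edges. -/
def hFree {W : Type*} (H : SimpleGraph W) : GraphClass :=
  fun _ => {G | H.Free G}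

/-- `G` is `ε`-far from `P`: more than `ε * |G|` edges have to be deleted from or inserted
to `G` to obtain a graph with property `P`. -/
def IsFar (P : GraphClass) (ε : ℝ) {n : ℕ} (G : SimpleGraph (Fin n)) : Prop :=
  ∀ G' : SimpleGraph (Fin n), G' ∈ P n →
    ε * (n : ℝ) < ((symmDiff G.edgeSet G'.edgeSet).ncard : ℝ)

/-! ### Testers in the random neighbor model -/

/-- What a tester may do next: make a random neighbor query at the vertex `v`, draw an integer
uniformly at random from `{0, …, m}` (no access to the graph), or stop and give its answer
(`true`: accept, `false`: reject). -/
inductive Action : Type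
  | query (v : ℕ) : Action
  | random (m : ℕ) : Action
  | answer (b : Bool) : Action

/-- Actions as a sum type, which makes them an effectively encoded type. -/
def Action.equivSum : Action ≃ ℕ ⊕ (ℕ ⊕ Bool) where
  toFun
    | .query v => Sum.inl v
    | .random m => Sum.inr (Sum.inl m)
    | .answer b => Sum.inr (Sum.inr b)
  invFun
    | Sum.inl v => .query v
    | Sum.inr (Sum.inl m) => .random m
    | Sum.inr (Sum.inr b) => .answer b
  left_inv a := by cases a <;> rfl
  right_inv a := by rcases a with v | m | b <;> rfl

instance : Primcodable Action := Primcodable.ofEquiv _ Action.equivSum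

/-- The action is a query to the oracle. -/
def Action.IsQuery : Action → Prop
  | .query _ => True
  | _ => False

/-- The list of the values received so far, in chronological order: outcomes of
the random draws and answers of the oracle. -/
abbrev Transcript : Type := List (Option ℕ)

/-- An algorithm with access to a random neighbor oracle. It knows the vertex set `{0, …, n - 1}`
of the input graph, and computes its next action from `n` and the values received so far. -/
structure Tester where
  next : ℕ → Transcript → Action
  computable : Computable₂ next

open Classical in
/-- The answer of the oracle for `G` to a query at `v`: a uniformly random neighbor of `v`, or
`none` if there is no such neighbor (`v` is isolated, or not a vertex). -/
noncomputable def randomNeighbor {n : ℕ} (G : SimpleGraph (Fin n)) (v : ℕ) : PMF (Option ℕ) :=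
  if h : ∃ hv : v < n, (G.neighborFinset ⟨v, hv⟩).Nonempty then
    (PMF.uniformOfFinset (G.neighborFinset ⟨v, h.1⟩) h.2).map fun w => some (w : ℕ)
  else
    PMF.pure none

namespace Tester

/-- One step of the tester on the input graph `G`. Nothing changes after it has answered. Fresh
randomness is used at every step. -/
noncomputable def step (T : Tester) {n : ℕ} (G : SimpleGraph (Fin n)) (t : Transcript) :
    PMF Transcript :=
  match T.next n t with
  | .query v => (randomNeighbor G v).map fun a => t ++ [a]
  | .random m => (PMF.uniformOfFintype (Fin (m + 1))).map fun k => t ++ [some (k : ℕ)]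
  | .answer _ => PMF.pure t

/-- The law of the transcript after `s` steps on the input graph `G`. -/
noncomputable def law (T : Tester) {n : ℕ} (G : SimpleGraph (Fin n)) : ℕ → PMF Transcript
  | 0 => PMF.pure []
  | s + 1 => (T.law G s).bind (T.step G)

/-- The number of queries made on a graph with `n` vertices in a run with transcript `t`. -/
noncomputable def numQueries (T : Tester) (n : ℕ) (t : Transcript) : ℕ :=
  {i : ℕ | i < t.length ∧ (T.next n (t.take i)).IsQuery}.ncard

/-- On the input graph `G`, every run of the tester stops with an answer, after having made at
most `q` queries. (As there are finitely many possible outcomes of each step, the number of steps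
is bounded if every run stops.) -/
def HaltsWithQueries (T : Tester) {n : ℕ} (G : SimpleGraph (Fin n)) (q : ℕ) : Prop :=
  ∃ s : ℕ, ∀ t ∈ (T.law G s).support,
    (∃ b : Bool, T.next n t = .answer b) ∧ T.numQueries n t ≤ q

/-- The probability that the tester answers `b` on the input graph `G`: the supremum (and limit)
over `s` of the probability that it has answered `b` within `s` steps. -/
noncomputable def probAnswer (T : Tester) {n : ℕ} (G : SimpleGraph (Fin n)) (b : Bool) : ℝ≥0∞ :=
  ⨆ s : ℕ, (T.law G s).toOuterMeasure {t | T.next n t = .answer b}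

end Tester

/-- `T` is a tester with one-sided error for the property `P` on graphs of the class `C`, with
proximity parameter `ε` and at most `q` queries. -/
structure IsOneSidedTester (P C : GraphClass) (ε : ℝ) (q : ℕ) (T : Tester) : Prop where
  halts : ∀ (n : ℕ) (G : SimpleGraph (Fin n)), G ∈ C n → T.HaltsWithQueries G q
  accepts : ∀ (n : ℕ) (G : SimpleGraph (Fin n)), G ∈ C n → G ∈ P n → T.probAnswer G true = 1
  rejects : ∀ (n : ℕ) (G : SimpleGraph (Fin n)), G ∈ C n → IsFar P ε G →
    2 / 3 ≤ T.probAnswer G false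

/-- In the random neighbor model, `P` is testable on graphs of `C` with constant query complexity
and one-sided error, for every proximity parameter `ε > 0`; the bound `q` on the number of queries
does not depend on the input graph. -/
def IsTestable (P C : GraphClass) : Prop :=
  ∀ ε : ℝ, 0 < ε → ∃ (q : ℕ) (T : Tester), IsOneSidedTester P C ε q T

end GraphTesting

namespace GraphTesting

/-! ### The tester and its computability -/

/-! A small treedepth order controls degrees: each edge joins comparable vertices, so each vertex
has at most `d` smaller neighbors and the degrees sum to at most `2 * d * n`. A random neighbor of a
vertex of bounded degree is any prescribed neighbor with constant probability, whereas a vertex of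
large degree can be left reliably only towards neighbors that are abundant.

If `G` is far from `H`-free, a maximal edge-disjoint packing of copies of `H` is linear in `n`, and
some colouring makes a constant fraction of it colourful; hence colourful copies survive any
deletion of few edges (`exists_coloring_of_far`). Few edges are then deleted so that
(`exists_isClean`) the larger end of each remaining edge has bounded degree, and anything occurring
in a colourful copy occurs often: as image of a vertex of `H` of bounded degree, or as neighbor of a
vertex while everything at or below that vertex in the order is kept fixed.

In the clean graph every partially discovered copy is extended with constant probability by one draw
or query (`IsClean.extend`). The target copy may change on the way: two colourful copies are glued
along a part of `H` whose boundary they share, and colours keep the result injective. Completing a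
copy takes boundedly many successes, so a block of boundedly many rounds succeeds with constant
probability whatever happened before (`IsExplorable.le_block`), and repeating blocks amplifies this
(`IsExplorable.not_found_le`).

The tester rejects only on a copy that it has seen, so the error is one-sided. Isolated vertices of
`H` cannot be found through edges; they are dropped, which matters only for graphs with fewer
vertices than `H`. -/

/-- The query made when `t` is the transcript so far: the last entry `p` of `t` is read as an
index, counting backwards from the entry before it. -/
def lookup (t : Transcript) : ℕ :=
  (t.reverse.getD ((t.reverse.getD 0 none).getD 0 + 1) none).getD 0

/-- The query made at step `3 * j + 2` shows the edge between `x` and `y`, in this direction. -/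
def Shows (t : Transcript) (j : ℕ) (x y : Option ℕ) : Prop :=
  some (lookup (t.take (3 * j + 2))) = x ∧ t.getD (3 * j + 2) none = y

/-- The queries made in the first `R` rounds show a copy of `H`. -/
def Found {W : Type*} (H : SimpleGraph W) (R : ℕ) (t : Transcript) : Prop :=
  ∃ f : W → Fin (3 * R),
    (∀ a, t.getD (f a) none ≠ none) ∧
    (∀ a b, a ≠ b → t.getD (f a) none ≠ t.getD (f b) none) ∧
    ∀ a b, H.Adj a b → ∃ j : Fin R,
      Shows t j (t.getD (f a) none) (t.getD (f b) none) ∨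
      Shows t j (t.getD (f b) none) (t.getD (f a) none)

open Classical in
/-- The tester makes `R` rounds. Each of them draws a random vertex, then an index in
`{0, …, m}`, and then queries the vertex that the index points to. It rejects a graph with
at least `N` vertices if the queries show a copy of `H`. -/
noncomputable def explore {W : Type*} (H : SimpleGraph W) (N m R n : ℕ) (t : Transcript) :
    Action :=
  if 3 * R ≤ t.length then .answer (!decide (N ≤ n ∧ Found H R t))
  else if t.length % 3 = 0 then .random (n - 1)
  else if t.length % 3 = 1 then .random m
  else .query (lookup t)

section Primrec

variable {α : Type*} [Primcodable α]

theorem primrecPred_const (c : Prop) : PrimrecPred fun _ : α => c := by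
  classical
  exact ⟨fun _ => Classical.dec c, Primrec.const _⟩

theorem primrecPred_exists_finset {ι : Type*} (s : Finset ι) {p : ι → α → Prop}
    (hp : ∀ i, PrimrecPred (p i)) : PrimrecPred fun x => ∃ i ∈ s, p i x := by
  classical
  induction s using Finset.induction_on with
  | empty => exact (primrecPred_const False).of_eq fun x => by simp
  | insert a s _ ih => exact ((hp a).or ih).of_eq fun x => by simp

theorem primrecPred_exists {ι : Type*} [Finite ι] {p : ι → α → Prop}
    (hp : ∀ i, PrimrecPred (p i)) : PrimrecPred fun x => ∃ i, p i x := by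
  cases nonempty_fintype ι
  exact (primrecPred_exists_finset Finset.univ hp).of_eq fun x => by simp

theorem primrecPred_forall {ι : Type*} [Finite ι] {p : ι → α → Prop}
    (hp : ∀ i, PrimrecPred (p i)) : PrimrecPred fun x => ∀ i, p i x :=
  (primrecPred_exists fun i => (hp i).not).not.of_eq fun x => by simp

theorem primrecPred_imp {p : α → Prop} (c : Prop) (hp : PrimrecPred p) :
    PrimrecPred fun x => c → p x :=
  ((primrecPred_const c).not.or hp).of_eq fun x => by tauto

theorem primrec_getD_const (i : ℕ) :
    Primrec fun t : Transcript => t.getD i none :=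
  (Primrec.list_getD none).comp Primrec.id (Primrec.const i)

theorem primrec_lookup : Primrec lookup := by
  have hv : Primrec fun o : Option ℕ => o.getD 0 :=
    Primrec.option_getD.comp Primrec.id (Primrec.const 0)
  have h0 : Primrec fun t : Transcript => (t.reverse.getD 0 none).getD 0 + 1 :=
    Primrec.succ.comp (hv.comp ((primrec_getD_const 0).comp Primrec.list_reverse))
  exact hv.comp ((Primrec.list_getD none).comp Primrec.list_reverse h0)

theorem primrecPred_shows (j : ℕ) {f g : Transcript → Option ℕ} (hf : Primrec f)
    (hg : Primrec g) : PrimrecPred fun t => Shows t j (f t) (g t) :=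
  (Primrec.eq.comp (Primrec.option_some.comp (primrec_lookup.comp
      (Primrec.list_take.comp (Primrec.const _) Primrec.id))) hf).and
    (Primrec.eq.comp (primrec_getD_const _) hg)

/-- With `H` and `R` fixed, all quantifiers range over finite types, so this is a finite Boolean
combination of comparisons between transcript entries. -/
theorem primrecPred_found {W : Type*} [Finite W] (H : SimpleGraph W) (R : ℕ) :
    PrimrecPred (Found H R) := by
  refine primrecPred_exists fun f => (PrimrecPred.and ?_ (PrimrecPred.and ?_ ?_))
  · exact primrecPred_forall fun a =>
      (Primrec.eq.comp (primrec_getD_const _) (Primrec.const none)).not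
  · exact primrecPred_forall fun a => primrecPred_forall fun b => primrecPred_imp _
      (Primrec.eq.comp (primrec_getD_const _) (primrec_getD_const _)).not
  · exact primrecPred_forall fun a => primrecPred_forall fun b => primrecPred_imp _
      (primrecPred_exists fun j =>
        (primrecPred_shows _ (primrec_getD_const _) (primrec_getD_const _)).or
        (primrecPred_shows _ (primrec_getD_const _) (primrec_getD_const _)))

theorem primrec_action_query : Primrec Action.query :=
  (Primrec.of_equiv_symm (e := Action.equivSum)).comp Primrec.sumInl

theorem primrec_action_random : Primrec Action.random :=
  (Primrec.of_equiv_symm (e := Action.equivSum)).comp (Primrec.sumInr.comp Primrec.sumInl)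

theorem primrec_action_answer : Primrec Action.answer :=
  (Primrec.of_equiv_symm (e := Action.equivSum)).comp (Primrec.sumInr.comp Primrec.sumInr)

theorem computable_explore {W : Type*} [Finite W] (H : SimpleGraph W) (N m R : ℕ) :
    Computable₂ (explore H N m R) := by
  classical
  have hlen : Primrec fun x : ℕ × Transcript => x.2.length :=
    Primrec.list_length.comp Primrec.snd
  have hmod (i : ℕ) : PrimrecPred fun x : ℕ × Transcript => x.2.length % 3 = i :=
    Primrec.eq.comp (Primrec.nat_mod.comp hlen (Primrec.const 3)) (Primrec.const i)
  have hfound : PrimrecPred fun x : ℕ × Transcript => N ≤ x.1 ∧ Found H R x.2 :=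
    (Primrec.nat_le.comp (Primrec.const N) Primrec.fst).and
      ((primrecPred_found H R).comp Primrec.snd)
  refine Primrec.to_comp (Primrec.ite (Primrec.nat_le.comp (Primrec.const _) hlen) ?_
    (Primrec.ite (hmod 0) ?_ (Primrec.ite (hmod 1) ?_ ?_)))
  · exact primrec_action_answer.comp (Primrec.not.comp hfound.decide)
  · exact primrec_action_random.comp (Primrec.nat_sub.comp Primrec.fst (Primrec.const 1))
  · exact primrec_action_random.comp (Primrec.const m)
  · exact primrec_action_query.comp (primrec_lookup.comp Primrec.snd)

end Primrec

/-- The tester with the strategy `explore`. -/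
noncomputable def explorer {W : Type*} [Finite W] (H : SimpleGraph W) (N m R : ℕ) : Tester where
  next := explore H N m R
  computable := computable_explore H N m R

/-! ### Probabilities of compound experiments -/

section PMF

variable {α β : Type*}

theorem le_toOuterMeasure_bind {p : PMF α} {f : α → PMF β} {A : Set α} {B : Set β} {x y : ℝ≥0∞}
    (hA : x ≤ p.toOuterMeasure A) (hB : ∀ a ∈ A, y ≤ (f a).toOuterMeasure B) :
    x * y ≤ (p.bind f).toOuterMeasure B := by
  rw [PMF.toOuterMeasure_bind_apply]
  calc x * y ≤ p.toOuterMeasure A * y := by gcongr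
    _ = ∑' a, A.indicator p a * y := by rw [PMF.toOuterMeasure_apply, ENNReal.tsum_mul_right]
    _ ≤ ∑' a, p a * (f a).toOuterMeasure B := by
      refine ENNReal.tsum_le_tsum fun a => ?_
      by_cases ha : a ∈ A
      · rw [Set.indicator_of_mem ha]
        gcongr
        exact hB a ha
      · simp [ha]

/-- Bounds the failure of repeated trials: `A` is failure so far, and after a success failure has
become impossible. -/
theorem toOuterMeasure_bind_le {p : PMF α} {f : α → PMF β} {A : Set α} {B : Set β} {x y : ℝ≥0∞}
    (hA : p.toOuterMeasure A ≤ x) (hB : ∀ a ∈ p.support, a ∈ A → (f a).toOuterMeasure B ≤ y)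
    (h0 : ∀ a ∈ p.support, a ∉ A → (f a).toOuterMeasure B = 0) :
    (p.bind f).toOuterMeasure B ≤ x * y := by
  rw [PMF.toOuterMeasure_bind_apply]
  calc ∑' a, p a * (f a).toOuterMeasure B ≤ ∑' a, A.indicator p a * y := by
        refine ENNReal.tsum_le_tsum fun a => ?_
        by_cases hs : p a = 0
        · simp [hs]
        have hs' : a ∈ p.support := (p.mem_support_iff a).2 hs
        by_cases ha : a ∈ A
        · rw [Set.indicator_of_mem ha]
          gcongr
          exact hB a hs' ha
        · simp [h0 a hs' ha]
    _ = p.toOuterMeasure A * y := by rw [PMF.toOuterMeasure_apply, ENNReal.tsum_mul_right]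
    _ ≤ x * y := by gcongr

theorem toOuterMeasure_add_compl (p : PMF α) (A : Set α) :
    p.toOuterMeasure A + p.toOuterMeasure Aᶜ = 1 := by
  rw [PMF.toOuterMeasure_apply, PMF.toOuterMeasure_apply, ← ENNReal.tsum_add, ← p.tsum_coe]
  refine tsum_congr fun a => ?_
  by_cases ha : a ∈ A <;> simp [ha]

theorem le_toOuterMeasure_map_uniformOfFintype [Fintype α] [Nonempty α] (f : α → β)
    (B : Finset α) {S : Set β} (h : ∀ a ∈ B, f a ∈ S) :
    (B.card : ℝ≥0∞) / Fintype.card α ≤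
      ((PMF.uniformOfFintype α).map f).toOuterMeasure S := by
  classical
  rw [PMF.toOuterMeasure_map_apply]
  refine le_trans ?_ (MeasureTheory.measure_mono (s := (B : Set α)) fun a ha => h a ha)
  rw [PMF.toOuterMeasure_uniformOfFintype_apply]
  simp

theorem le_toOuterMeasure_map_uniformOfFinset {s : Finset α} (hs : s.Nonempty) (f : α → β)
    {A : Finset α} (hA : A ⊆ s) {S : Set β} (h : ∀ a ∈ A, f a ∈ S) :
    (A.card : ℝ≥0∞) / s.card ≤ ((PMF.uniformOfFinset s hs).map f).toOuterMeasure S := by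
  classical
  rw [PMF.toOuterMeasure_map_apply]
  refine le_trans ?_ (MeasureTheory.measure_mono (s := (A : Set α)) fun a ha => h a ha)
  rw [PMF.toOuterMeasure_uniformOfFinset_apply]
  gcongr
  intro a ha
  simp [hA ha, ha]

theorem map_bind_pure {γ : Type*} (p : PMF α) (g : α → β) (f : β → γ) :
    (p.bind fun a => PMF.pure (g a)).map f = p.map fun a => f (g a) := by
  simp only [PMF.map_bind, PMF.pure_map]
  rfl

end PMF

/-! ### Runs of a tester from a given transcript -/

namespace Tester

/-- The law of the transcript after `s` further steps, starting from the transcript `t`. -/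
noncomputable def run (T : Tester) {n : ℕ} (G : SimpleGraph (Fin n)) :
    ℕ → Transcript → PMF Transcript
  | 0, t => PMF.pure t
  | s + 1, t => (T.run G s t).bind (T.step G)

theorem law_eq_run (T : Tester) {n : ℕ} (G : SimpleGraph (Fin n)) (s : ℕ) :
    T.law G s = T.run G s [] := by
  induction s with
  | zero => rfl
  | succ s ih => rw [law, run, ih]

theorem run_add (T : Tester) {n : ℕ} (G : SimpleGraph (Fin n)) (a b : ℕ) (t : Transcript) :
    T.run G (a + b) t = (T.run G a t).bind (T.run G b) := by
  induction b with
  | zero => exact (PMF.bind_pure _).symm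
  | succ b ih => rw [← Nat.add_assoc, run, ih, PMF.bind_bind]; rfl

theorem le_run_of_le_round (T : Tester) {n : ℕ} (G : SimpleGraph (Fin n)) {S : ℕ → Set Transcript}
    {c : ℝ≥0∞} {L : ℕ} {t : Transcript} (h0 : t ∈ S 0)
    (hS : ∀ j < L, ∀ t ∈ S j, c ≤ (T.run G 3 t).toOuterMeasure (S (j + 1))) :
    c ^ L ≤ (T.run G (3 * L) t).toOuterMeasure (S L) := by
  induction L with
  | zero => simp [run, h0]
  | succ L ih =>
    rw [Nat.mul_succ, run_add, pow_succ]
    exact le_toOuterMeasure_bind (ih fun j hj => hS j (by omega)) (hS L (by omega))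

end Tester

section Explorer

variable {W : Type*} [Finite W] (H : SimpleGraph W) (N m R : ℕ) {n : ℕ} (G : SimpleGraph (Fin n))

theorem step_explorer_draw_vertex {t : Transcript} (h : t.length < 3 * R)
    (h3 : t.length % 3 = 0) :
    (explorer H N m R).step G t =
      (PMF.uniformOfFintype (Fin (n - 1 + 1))).map
        fun k : Fin (n - 1 + 1) => t ++ [some (k : ℕ)] := by
  have : (explorer H N m R).next n t = .random (n - 1) := by
    simp [explorer, explore, h3, h]
  rw [Tester.step, this]
  exact map_bind_pure _ _ _

theorem step_explorer_draw_index {t : Transcript} (h : t.length < 3 * R)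
    (h3 : t.length % 3 = 1) :
    (explorer H N m R).step G t =
      (PMF.uniformOfFintype (Fin (m + 1))).map fun k : Fin (m + 1) => t ++ [some (k : ℕ)] := by
  have : (explorer H N m R).next n t = .random m := by
    simp [explorer, explore, h3, h]
  rw [Tester.step, this]
  exact map_bind_pure _ _ _

theorem step_explorer_query {t : Transcript} (h : t.length < 3 * R)
    (h3 : t.length % 3 = 2) :
    (explorer H N m R).step G t =
      (randomNeighbor G (lookup t)).map fun a => t ++ [a] := by
  have : (explorer H N m R).next n t = .query (lookup t) := by
    simp [explorer, explore, h3, h]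
  rw [Tester.step, this]

theorem exists_of_mem_support_step {t t' : Transcript} (h : t.length < 3 * R)
    (ht : t' ∈ ((explorer H N m R).step G t).support) : ∃ a, t' = t ++ [a] := by
  have h3 : t.length % 3 = 0 ∨ t.length % 3 = 1 ∨ t.length % 3 = 2 := by omega
  rcases h3 with h3 | h3 | h3
  · rw [step_explorer_draw_vertex _ _ _ _ _ h h3] at ht
    simp only [PMF.mem_support_map_iff] at ht
    obtain ⟨k, -, rfl⟩ := ht
    exact ⟨_, rfl⟩
  · rw [step_explorer_draw_index _ _ _ _ _ h h3] at ht
    simp only [PMF.mem_support_map_iff] at ht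
    obtain ⟨k, -, rfl⟩ := ht
    exact ⟨_, rfl⟩
  · rw [step_explorer_query _ _ _ _ _ h h3] at ht
    simp only [PMF.mem_support_map_iff] at ht
    obtain ⟨k, -, rfl⟩ := ht
    exact ⟨_, rfl⟩

theorem exists_of_mem_support_run {t t' : Transcript} {s : ℕ} (h : t.length + s ≤ 3 * R)
    (ht : t' ∈ ((explorer H N m R).run G s t).support) : ∃ u, t' = t ++ u ∧ u.length = s := by
  induction s generalizing t' with
  | zero =>
    simp only [Tester.run, PMF.support_pure, Set.mem_singleton_iff] at ht
    exact ⟨[], by simp [ht]⟩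
  | succ s ih =>
    simp only [Tester.run, PMF.mem_support_bind_iff] at ht
    obtain ⟨t₁, h₁, ht⟩ := ht
    obtain ⟨u, rfl, hu⟩ := ih (by omega) h₁
    obtain ⟨a, rfl⟩ := exists_of_mem_support_step H N m R G (by simp; omega) ht
    exact ⟨u ++ [a], by simp, by simp [hu]⟩

/-! #### Soundness -/

/-- All the edges that the queries show are edges of `G`. -/
def IsSound (t : Transcript) : Prop :=
  ∀ j w, t.getD (3 * j + 2) none = some w →
    ∃ (hv : lookup (t.take (3 * j + 2)) < n) (hw : w < n), G.Adj ⟨_, hv⟩ ⟨w, hw⟩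

theorem randomNeighbor_eq_map {v : Fin n} [Fintype (G.neighborSet v)]
    (h : (G.neighborFinset v).Nonempty) :
    randomNeighbor G v =
      (PMF.uniformOfFinset (G.neighborFinset v) h).map fun w : Fin n => some (w : ℕ) := by
  rw [randomNeighbor, dif_pos ⟨v.2, by convert h⟩]
  refine (map_bind_pure _ _ _).trans ?_
  congr!

theorem adj_of_mem_support_randomNeighbor {v w : ℕ}
    (h : some w ∈ (randomNeighbor G v).support) :
    ∃ (hv : v < n) (hw : w < n), G.Adj ⟨v, hv⟩ ⟨w, hw⟩ := by
  classical
  by_cases hv : ∃ hv : v < n, (G.neighborFinset ⟨v, hv⟩).Nonempty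
  · obtain ⟨hv, hne⟩ := hv
    rw [show v = ((⟨v, hv⟩ : Fin n) : ℕ) from rfl, randomNeighbor_eq_map G hne] at h
    simp only [PMF.mem_support_map_iff, PMF.mem_support_uniformOfFinset_iff,
      SimpleGraph.mem_neighborFinset, Option.some.injEq] at h
    obtain ⟨x, hx, rfl⟩ := h
    exact ⟨hv, x.2, hx⟩
  · rw [randomNeighbor, dif_neg (by convert hv)] at h
    simp at h

theorem IsSound.append {t : Transcript} {a : Option ℕ} (h : IsSound G t)
    (ha : ∀ w, t.length % 3 = 2 → a = some w →
      ∃ (hv : lookup t < n) (hw : w < n), G.Adj ⟨_, hv⟩ ⟨w, hw⟩) :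
    IsSound G (t ++ [a]) := by
  intro j w hw
  rcases lt_trichotomy (3 * j + 2) t.length with hlt | heq | hgt
  · rw [List.getD_append _ _ _ _ hlt] at hw
    rw [List.take_append_of_le_length hlt.le]
    exact h j w hw
  · rw [List.getD_append_right _ _ _ _ heq.ge] at hw
    rw [List.take_append_of_le_length heq.le, heq, List.take_length]
    exact ha w (by omega) (by simpa [heq] using hw)
  · rw [List.getD_eq_default _ _ (by simp; omega)] at hw
    simp at hw

theorem isSound_of_mem_support_law {t : Transcript} {s : ℕ} (h : s ≤ 3 * R)
    (ht : t ∈ ((explorer H N m R).law G s).support) : IsSound G t := by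
  induction s generalizing t with
  | zero =>
    simp only [Tester.law, PMF.support_pure, Set.mem_singleton_iff] at ht
    subst ht
    intro j w hw
    simp at hw
  | succ s ih =>
    simp only [Tester.law, PMF.mem_support_bind_iff] at ht
    obtain ⟨t₁, h₁, ht⟩ := ht
    have hs := ih (by omega) h₁
    rw [Tester.law_eq_run] at h₁
    have hl : t₁.length < 3 * R := by
      obtain ⟨u, rfl, hu⟩ :=
        exists_of_mem_support_run H N m R G (by simp only [List.length_nil]; omega) h₁
      omega
    by_cases h3 : t₁.length % 3 = 2
    · rw [step_explorer_query _ _ _ _ _ hl h3] at ht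
      simp only [PMF.mem_support_map_iff] at ht
      obtain ⟨a, ha, rfl⟩ := ht
      refine hs.append G fun w _ hw => ?_
      subst hw
      exact adj_of_mem_support_randomNeighbor G ha
    · obtain ⟨a, rfl⟩ := exists_of_mem_support_step H N m R G hl ht
      exact hs.append G fun w hw => absurd hw h3

/-! #### One round -/

theorem le_round_of_draw_vertex {t : Transcript} (h3 : t.length % 3 = 0)
    (h : t.length + 3 ≤ 3 * R) (hn : 0 < n) (B : Finset (Fin n)) {S : Set Transcript}
    (hS : ∀ r ∈ B, ∀ x y, t ++ [some (r : ℕ), x, y] ∈ S) {c : ℝ≥0∞} (hc : c * n ≤ B.card) :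
    c ≤ ((explorer H N m R).run G 3 t).toOuterMeasure S := by
  -- The draw ranges over `n - 1 + 1` values because of truncated subtraction; these are the
  -- vertices only if `n > 0`.
  have hn' : n - 1 + 1 = n := by omega
  have hrun : (explorer H N m R).run G 3 t =
      ((explorer H N m R).step G t).bind ((explorer H N m R).run G 2) := by
    rw [show 3 = 1 + 2 from rfl, Tester.run_add]
    simp [Tester.run]
  rw [hrun, ← mul_one c]
  refine le_toOuterMeasure_bind (A := {t' | ∃ r ∈ B, t' = t ++ [some (r : ℕ)]}) ?_ ?_
  · rw [step_explorer_draw_vertex _ _ _ _ _ (by omega) h3]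
    refine le_trans ?_ (le_toOuterMeasure_map_uniformOfFintype _
      (B.map (finCongr hn'.symm).toEmbedding) ?_)
    · rw [Finset.card_map, Fintype.card_fin, hn']
      exact (ENNReal.le_div_iff_mul_le (.inl (by positivity)) (.inl (by simp))).2 hc
    · intro a ha
      obtain ⟨r, hr, rfl⟩ := Finset.mem_map.1 ha
      exact ⟨r, hr, by simp⟩
  · rintro _ ⟨r, hr, rfl⟩
    refine le_of_eq (Eq.symm ?_)
    rw [PMF.toOuterMeasure_apply_eq_one_iff]
    intro t' ht'
    obtain ⟨u, rfl, hu⟩ := exists_of_mem_support_run H N m R G (by simp; omega) ht'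
    obtain ⟨x, y, rfl⟩ := List.length_eq_two.1 hu
    simpa using hS r hr x y

theorem le_toOuterMeasure_randomNeighbor {v : Fin n} [Fintype (G.neighborSet v)]
    {A : Finset (Fin n)} (hA : A ⊆ G.neighborFinset v) (hne : A.Nonempty)
    {S : Set (Option ℕ)} (hS : ∀ w ∈ A, some (w : ℕ) ∈ S) {c : ℝ≥0∞}
    (hc : c * G.degree v ≤ A.card) :
    c ≤ (randomNeighbor G v).toOuterMeasure S := by
  classical
  have hs : (G.neighborFinset v).Nonempty := hne.mono hA
  have hdeg : (0 : ℝ≥0∞) < G.degree v := by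
    rw [← G.card_neighborFinset_eq_degree]
    exact_mod_cast hs.card_pos
  rw [randomNeighbor_eq_map G hs]
  refine le_trans ?_ (le_toOuterMeasure_map_uniformOfFinset _ _ hA hS)
  rw [G.card_neighborFinset_eq_degree]
  exact (ENNReal.le_div_iff_mul_le (.inl hdeg.ne') (.inl (by simp))).2 hc

theorem le_round_of_query {t : Transcript} (h3 : t.length % 3 = 0)
    (h : t.length + 3 ≤ 3 * R) {v : Fin n} {i : ℕ} (hi : i < m)
    (hv : t.reverse.getD i none = some (v : ℕ)) [Fintype (G.neighborSet v)]
    {A : Finset (Fin n)} (hA : A ⊆ G.neighborFinset v) (hne : A.Nonempty) {S : Set Transcript}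
    (hS : ∀ r p, lookup (t ++ [r, p]) = v → ∀ w ∈ A, t ++ [r, p, some (w : ℕ)] ∈ S)
    {c : ℝ≥0∞} (hc : c * G.degree v ≤ A.card) :
    (m + 1 : ℝ≥0∞)⁻¹ * c ≤ ((explorer H N m R).run G 3 t).toOuterMeasure S := by
  have hrun : (explorer H N m R).run G 3 t =
      (((explorer H N m R).step G t).bind ((explorer H N m R).step G)).bind
        ((explorer H N m R).step G) := by
    simp [Tester.run]
  rw [hrun, ← one_mul (_⁻¹)]
  refine le_toOuterMeasure_bind
    (A := {t' | ∃ r, t' = t ++ [r, some (i + 1)]}) (le_toOuterMeasure_bind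
      (A := {t' | ∃ r, t' = t ++ [r]}) ?_ ?_) ?_
  · refine le_of_eq (Eq.symm ((PMF.toOuterMeasure_apply_eq_one_iff _ _).2 fun t' ht' => ?_))
    exact exists_of_mem_support_step H N m R G (by omega) ht'
  · rintro _ ⟨r, rfl⟩
    rw [step_explorer_draw_index _ _ _ _ _ (by simp; omega) (by simp; omega)]
    -- Index `0` points to the vertex drawn in this round, so the `i`-th entry of the reversed old
    -- transcript has index `i + 1`.
    have hi' : i + 1 < m + 1 := by omega
    refine le_trans ?_ (le_toOuterMeasure_map_uniformOfFintype _
      ({⟨i + 1, hi'⟩} : Finset (Fin (m + 1))) ?_)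
    · simp
    · intro a ha
      obtain rfl := Finset.mem_singleton.1 ha
      exact ⟨r, by simp⟩
  · rintro _ ⟨r, rfl⟩
    have hl : lookup (t ++ [r, some (i + 1)]) = v := by
      simp only [lookup, List.reverse_append, List.reverse_cons, List.reverse_nil, List.nil_append,
        List.cons_append, List.getD_cons_zero, List.getD_cons_succ, Option.getD_some]
      rw [hv, Option.getD_some]
    rw [step_explorer_query _ _ _ _ _ (by simp; omega) (by simp; omega), hl,
      PMF.toOuterMeasure_map_apply]
    refine le_toOuterMeasure_randomNeighbor G hA hne (fun w hw => ?_) hc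
    simpa using hS r _ hl w hw

end Explorer

/-- A transcript mixes vertices with drawn indices, but this does no harm: as `H` has no isolated
vertex, every value used in the copy is an end of a shown edge, hence a vertex of `G`. -/
theorem exists_copy_of_found {W : Type*} {H : SimpleGraph W} {R n : ℕ}
    {G : SimpleGraph (Fin n)} (hH : ∀ a, ∃ b, H.Adj a b) {t : Transcript} (ht : IsSound G t)
    (hf : Found H R t) :
    ∃ φ : W → Fin n, Function.Injective φ ∧ ∀ a b, H.Adj a b → G.Adj (φ a) (φ b) := by
  obtain ⟨f, h1, h2, h3⟩ := hf
  choose x hx using fun a => Option.ne_none_iff_exists.1 (h1 a)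
  have key : ∀ a b, H.Adj a b → ∃ (ha : x a < n) (hb : x b < n), G.Adj ⟨_, ha⟩ ⟨_, hb⟩ := by
    intro a b hab
    obtain ⟨j, hj⟩ := h3 a b hab
    rw [← hx a, ← hx b] at hj
    rcases hj with ⟨hj1, hj2⟩ | ⟨hj1, hj2⟩
    · obtain ⟨hv, hw, hadj⟩ := ht j _ hj2
      simp only [Option.some.inj hj1] at hv hadj
      exact ⟨hv, hw, hadj⟩
    · obtain ⟨hv, hw, hadj⟩ := ht j _ hj2
      simp only [Option.some.inj hj1] at hv hadj
      exact ⟨hw, hv, hadj.symm⟩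
  have hlt : ∀ a, x a < n := fun a => by
    obtain ⟨b, hb⟩ := hH a
    exact (key a b hb).1
  refine ⟨fun a => ⟨x a, hlt a⟩, fun a b hab => ?_, fun a b hab => ?_⟩
  · by_contra hne
    refine h2 a b hne ?_
    rw [← hx a, ← hx b, Fin.mk.inj_iff.1 hab]
  · obtain ⟨_, _, h⟩ := key a b hab
    exact h

/-! ### Families of copies that can be explored -/

open Classical in
/-- A nonempty family `Φ` of copies of `H` in `G` such that every partial knowledge of a copy
from `Φ` (the vertices in `K` are known, and so are the edges in `F`) is extended, with probability
at least `δ`, either by a random vertex, or by a random neighbor of some known vertex. In both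
cases the copy may be replaced with one that agrees with it on the known vertices. -/
structure IsExplorable {W : Type*} (H : SimpleGraph W) {n : ℕ} (G : SimpleGraph (Fin n))
    (δ : ℝ≥0∞) (Φ : Set (W → Fin n)) : Prop where
  nonempty : Φ.Nonempty
  injective : ∀ φ ∈ Φ, Function.Injective φ
  extend : ∀ φ ∈ Φ, ∀ (K : Set W) (F : W → W → Prop), (∀ a b, F a b → F b a) →
    ((∀ a, a ∈ K) ∧ ∀ a b, H.Adj a b → F a b) ∨
    (∃ c ∉ K, ∃ B : Finset (Fin n), δ * n ≤ B.card ∧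
      ∀ w ∈ B, ∃ φ' ∈ Φ, (∀ a ∈ K, φ' a = φ a) ∧ φ' c = w) ∨
    ∃ c ∈ K, ∃ c', H.Adj c c' ∧ (c' ∈ K → ¬ F c c') ∧
      ∃ A ⊆ G.neighborFinset (φ c), A.Nonempty ∧ δ * G.degree (φ c) ≤ A.card ∧
        ∀ w ∈ A, ∃ φ' ∈ Φ, (∀ a ∈ K, φ' a = φ a) ∧ φ' c' = w

theorem Shows.append {t : Transcript} {j : ℕ} {x y : Option ℕ} (h : Shows t j x y)
    (hy : y ≠ none) (u : Transcript) : Shows (t ++ u) j x y := by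
  have hlt : 3 * j + 2 < t.length := by
    by_contra hge
    exact hy (by rw [← h.2, List.getD_eq_default _ _ (by omega)])
  refine ⟨?_, ?_⟩
  · rw [List.take_append_of_le_length hlt.le]
    exact h.1
  · rw [List.getD_append _ _ _ _ hlt]
    exact h.2

theorem getD_append_of_ne_none {t : Transcript} {i : ℕ} (h : t.getD i none ≠ none)
    (u : Transcript) : (t ++ u).getD i none = t.getD i none := by
  have hlt : i < t.length := by
    by_contra hge
    exact h (by rw [List.getD_eq_default _ _ (by omega)])
  rw [List.getD_append _ _ _ _ hlt]

theorem Found.append {W : Type*} {H : SimpleGraph W} {R : ℕ} {t : Transcript}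
    (h : Found H R t) (u : Transcript) : Found H R (t ++ u) := by
  obtain ⟨f, h1, h2, h3⟩ := h
  have hf : ∀ a, (t ++ u).getD (f a) none = t.getD (f a) none := fun a =>
    getD_append_of_ne_none (h1 a) u
  simp only [← hf] at h1 h2
  refine ⟨f, h1, h2, fun a b hab => ?_⟩
  obtain ⟨j, hj⟩ := h3 a b hab
  rw [hf, hf]
  exact ⟨j, hj.imp (fun h => h.append (hf b ▸ h1 b) u) fun h => h.append (hf a ▸ h1 a) u⟩

/-- The edge of `G` between the images of `a` and `b` is shown by some query. -/
def ShowsEdge {W : Type*} {n : ℕ} (t : Transcript) (φ : W → Fin n) (a b : W) : Prop :=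
  ∃ j, Shows t j (some (φ a : ℕ)) (some (φ b : ℕ)) ∨ Shows t j (some (φ b : ℕ)) (some (φ a : ℕ))

theorem ShowsEdge.symm {W : Type*} {n : ℕ} {t : Transcript} {φ : W → Fin n} {a b : W}
    (h : ShowsEdge t φ a b) : ShowsEdge t φ b a := by
  obtain ⟨j, h⟩ := h
  exact ⟨j, h.symm⟩

theorem ShowsEdge.append {W : Type*} {n : ℕ} {t : Transcript} {φ : W → Fin n} {a b : W}
    (h : ShowsEdge t φ a b) (u : Transcript) : ShowsEdge (t ++ u) φ a b := by
  obtain ⟨j, h⟩ := h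
  exact ⟨j, h.imp (fun h => h.append (by simp) u) fun h => h.append (by simp) u⟩

theorem showsEdge_append {W : Type*} {n : ℕ} {t : Transcript} {φ : W → Fin n} {c c' : W}
    {r p : Option ℕ} (h3 : t.length % 3 = 0) (hl : lookup (t ++ [r, p]) = φ c) :
    ShowsEdge (t ++ [r, p, some (φ c' : ℕ)]) φ c c' := by
  refine ⟨t.length / 3, .inl ⟨?_, ?_⟩⟩
  · have : (t ++ [r, p, some (φ c' : ℕ)]).take (3 * (t.length / 3) + 2) = t ++ [r, p] := by
      rw [show t ++ [r, p, some (φ c' : ℕ)] = (t ++ [r, p]) ++ [some (φ c' : ℕ)] by simp,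
        List.take_append_of_le_length (by simp; omega), List.take_of_length_le (by simp; omega)]
    rw [this, hl]
  · rw [List.getD_append_right _ _ _ _ (by omega),
      show 3 * (t.length / 3) + 2 - t.length = 2 by omega]
    rfl

/-- The pairs of vertices of `H` whose images appear in `u` and which are equal or joined by an
edge shown in `t`. -/
def knownPairs {W : Type*} {n : ℕ} (t u : Transcript) (φ : W → Fin n) : Set (W × W) :=
  {x | some (φ x.1 : ℕ) ∈ u ∧ some (φ x.2 : ℕ) ∈ u ∧ (x.1 = x.2 ∨ ShowsEdge t φ x.1 x.2)}

theorem knownPairs_subset_append {W : Type*} {n : ℕ} {t u : Transcript} {φ φ' : W → Fin n}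
    (h : ∀ a, some (φ a : ℕ) ∈ u → φ' a = φ a) (s : Transcript) :
    knownPairs t u φ ⊆ knownPairs (t ++ s) (u ++ s) φ' := by
  rintro ⟨a, b⟩ ⟨ha, hb, hab⟩
  refine ⟨?_, ?_, ?_⟩
  · simp [h a ha, ha]
  · simp [h b hb, hb]
  · refine hab.imp id fun hab => ?_
    have := hab.append s
    unfold ShowsEdge at this ⊢
    simpa only [h a ha, h b hb] using this

/-- The transcript has come to know at least `j` pairs, within `j` rounds after `t₀`. -/
def progressSet {W : Type*} (H : SimpleGraph W) {n : ℕ} (Φ : Set (W → Fin n)) (t₀ : Transcript)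
    (j : ℕ) : Set Transcript :=
  {t | ∃ u, t = t₀ ++ u ∧ u.length = 3 * j ∧ ∃ φ ∈ Φ,
    ((∀ a, some (φ a : ℕ) ∈ u) ∧ ∀ a b, H.Adj a b → ShowsEdge t φ a b) ∨
      j ≤ (knownPairs t u φ).ncard}

theorem found_of_complete {W : Type*} {H : SimpleGraph W} {n R : ℕ} {t : Transcript}
    (ht : t.length ≤ 3 * R) {φ : W → Fin n} (hφ : Function.Injective φ)
    (h1 : ∀ a, some (φ a : ℕ) ∈ t) (h2 : ∀ a b, H.Adj a b → ShowsEdge t φ a b) :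
    Found H R t := by
  choose i hi hit using fun a => List.mem_iff_getElem.1 (h1 a)
  have hget : ∀ a, t.getD (i a) none = some (φ a : ℕ) := fun a => by
    rw [List.getD_eq_getElem _ _ (hi a), hit]
  refine ⟨fun a => ⟨i a, (hi a).trans_le ht⟩, fun a => ?_, fun a b hab => ?_, fun a b hab => ?_⟩
  · simp only [hget]
    simp
  · simp only [hget, ne_eq, Option.some.injEq, Fin.val_inj]
    exact fun h => hab (hφ h)
  · obtain ⟨j, hj⟩ := h2 a b hab
    have hlt : j < R := by
      by_contra hge
      have hd : t.getD (3 * j + 2) none = none := List.getD_eq_default _ _ (by omega)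
      rcases hj with hj | hj <;> · have := hj.2; rw [hd] at this; simp at this
    exact ⟨⟨j, hlt⟩, by simpa only [hget] using hj⟩

/-! ### Success probability of a round, of a block of rounds, and of repeated blocks. -/

section Rejects

variable {W : Type*} [Finite W] {H : SimpleGraph W} {n : ℕ} {G : SimpleGraph (Fin n)}
  {δ : ℝ≥0∞} {Φ : Set (W → Fin n)}

/-- Progress is measured by `knownPairs`: a diagonal pair is a discovered vertex, any other pair a
discovered edge. A draw succeeds with probability `δ`; a query also has to hit the right index,
which costs the factor `(3 * L + 1)⁻¹`. -/
theorem IsExplorable.le_round (hΦ : IsExplorable H G δ Φ) (hδ : δ ≤ 1) (N R : ℕ) {L : ℕ}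
    {t₀ t : Transcript} (h₀ : t₀.length % 3 = 0) (hR : t₀.length + 3 * L ≤ 3 * R) {j : ℕ}
    (hj : j < L) (ht : t ∈ progressSet H Φ t₀ j) :
    (3 * L + 1 : ℝ≥0∞)⁻¹ * δ ≤
      ((explorer H N (3 * L) R).run G 3 t).toOuterMeasure (progressSet H Φ t₀ (j + 1)) := by
  classical
  obtain ⟨u, rfl, hu, φ, hφ, hp⟩ := ht
  have hlen : (t₀ ++ u).length + 3 ≤ 3 * R := by simp; omega
  have hmod : (t₀ ++ u).length % 3 = 0 := by simp; omega
  have hle1 : (3 * L + 1 : ℝ≥0∞)⁻¹ ≤ 1 := by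
    rw [ENNReal.inv_le_one]
    exact le_add_self
  have hleδ : (3 * L + 1 : ℝ≥0∞)⁻¹ * δ ≤ δ := mul_le_of_le_one_left zero_le hle1
  -- One new pair is enough: old pairs persist since the new copy agrees with the old one on all
  -- known vertices.
  have hgrow : ∀ (s : Transcript) (φ' : W → Fin n), s.length = 3 → φ' ∈ Φ →
      (∀ a, some (φ a : ℕ) ∈ u → φ' a = φ a) → j ≤ (knownPairs (t₀ ++ u) u φ).ncard →
      (∃ x, x ∉ knownPairs (t₀ ++ u) u φ ∧ x ∈ knownPairs (t₀ ++ u ++ s) (u ++ s) φ') →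
      t₀ ++ u ++ s ∈ progressSet H Φ t₀ (j + 1) := by
    rintro s φ' hs hφ' hag hjle ⟨x, hx1, hx2⟩
    refine ⟨u ++ s, by simp, by simp; omega, φ', hφ', .inr ?_⟩
    have hss : knownPairs (t₀ ++ u) u φ ⊂ knownPairs (t₀ ++ u ++ s) (u ++ s) φ' :=
      ⟨knownPairs_subset_append hag s, fun h => hx1 (h hx2)⟩
    have := Set.ncard_lt_ncard hss (Set.toFinite _)
    omega
  by_cases hcomp : (∀ a, some (φ a : ℕ) ∈ u) ∧ ∀ a b, H.Adj a b → ShowsEdge (t₀ ++ u) φ a b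
  · have : ((explorer H N (3 * L) R).run G 3 (t₀ ++ u)).toOuterMeasure
        (progressSet H Φ t₀ (j + 1)) = 1 := by
      rw [PMF.toOuterMeasure_apply_eq_one_iff]
      intro t' ht'
      obtain ⟨s, rfl, hs⟩ := exists_of_mem_support_run H N _ R G hlen ht'
      exact ⟨u ++ s, by simp, by simp; omega, φ, hφ, .inl
        ⟨fun a => by simp [hcomp.1 a], fun a b hab => (hcomp.2 a b hab).append s⟩⟩
    rw [this]
    exact hleδ.trans hδ
  have hjle := hp.resolve_left hcomp
  rcases hΦ.extend φ hφ {a | some (φ a : ℕ) ∈ u} (ShowsEdge (t₀ ++ u) φ)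
    (fun a b h => h.symm) with h | ⟨c, hc, B, hB, hext⟩ |
      ⟨c, hc, c', hadj, hnew, A, hA, hne, hcard, hext⟩
  · exact absurd h hcomp
  · refine hleδ.trans (le_round_of_draw_vertex H N _ R G hmod hlen (φ c).pos B
      (fun r hr x y => ?_) hB)
    obtain ⟨φ', hφ', hag, hr'⟩ := hext r hr
    refine hgrow [some (r : ℕ), x, y] φ' rfl hφ' hag hjle ⟨(c, c), fun h => hc h.1, ?_⟩
    have : some (φ' c : ℕ) ∈ u ++ [some (r : ℕ), x, y] := by simp [hr']
    exact ⟨this, this, .inl rfl⟩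
  · obtain ⟨i, hi, hget⟩ := List.mem_iff_getElem.1 (List.mem_reverse.2 hc)
    -- Known vertices are only those seen since `t₀`, so a bounded window of indices reaches all of
    -- them, however long the transcript is.
    have hi' : i < 3 * L := by
      rw [List.length_reverse] at hi
      omega
    have hv : (t₀ ++ u).reverse.getD i none = some (φ c : ℕ) := by
      rw [List.reverse_append, List.getD_append _ _ _ _ hi, List.getD_eq_getElem _ _ hi, hget]
    have := le_round_of_query H N (3 * L) R G hmod hlen hi' hv hA hne
      (S := progressSet H Φ t₀ (j + 1)) (c := δ) (fun r p hl w hw => ?_) hcard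
    · simpa using this
    obtain ⟨φ', hφ', hag, rfl⟩ := hext w hw
    rw [← hag c hc] at hl
    refine hgrow [r, p, some (φ' c' : ℕ)] φ' rfl hφ' hag hjle ⟨(c, c'), ?_, ?_, ?_, ?_⟩
    · rintro ⟨-, h2, h | h⟩
      · exact hadj.ne h
      · exact hnew h2 h
    · simp [hag c hc, show some (φ c : ℕ) ∈ u from hc]
    · simp
    · exact .inr (showsEdge_append hmod hl)

/-- There are only `Nat.card W ^ 2` pairs, so after `L` successful rounds the copy must be complete.
The bound does not depend on the starting transcript `t₀`, which allows blocks to be iterated. -/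
theorem IsExplorable.le_block (hΦ : IsExplorable H G δ Φ) (hδ : δ ≤ 1) (N R : ℕ) {L : ℕ}
    (hL : Nat.card W ^ 2 < L) {t₀ : Transcript} (h₀ : t₀.length % 3 = 0)
    (hR : t₀.length + 3 * L ≤ 3 * R) :
    ((3 * L + 1 : ℝ≥0∞)⁻¹ * δ) ^ L ≤
      ((explorer H N (3 * L) R).run G (3 * L) t₀).toOuterMeasure {t | Found H R t} := by
  obtain ⟨φ, hφ⟩ := hΦ.nonempty
  have hmem : t₀ ∈ progressSet H Φ t₀ 0 :=
    ⟨[], by simp, by simp, φ, hφ, .inr (Nat.zero_le _)⟩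
  refine ((explorer H N (3 * L) R).le_run_of_le_round G hmem
    fun j hj t ht => hΦ.le_round hδ N R h₀ hR hj ht).trans ?_
  refine MeasureTheory.measure_mono ?_
  rintro _ ⟨u, rfl, hu, φ, hφ, hp⟩
  have hcard : (knownPairs (t₀ ++ u) u φ).ncard ≤ Nat.card W ^ 2 := by
    refine (Set.ncard_le_card _).trans ?_
    rw [Nat.card_prod, sq]
  have hc := hp.resolve_right (by omega)
  refine found_of_complete (by simp; omega) (hΦ.injective φ hφ) (fun a => ?_) hc.2
  simp [hc.1 a]

theorem IsExplorable.not_found_le (hΦ : IsExplorable H G δ Φ) (hδ : δ ≤ 1) (N R : ℕ) {L : ℕ}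
    (hL : Nat.card W ^ 2 < L) {k : ℕ} (hk : L * k ≤ R) :
    ((explorer H N (3 * L) R).run G (3 * L * k) []).toOuterMeasure {t | Found H R t}ᶜ ≤
      (1 - ((3 * L + 1 : ℝ≥0∞)⁻¹ * δ) ^ L) ^ k := by
  induction k with
  | zero =>
    rw [pow_zero, ← toOuterMeasure_add_compl _ {t | Found H R t}]
    exact le_add_self
  | succ k ih =>
    rw [Nat.mul_succ] at hk
    rw [Nat.mul_succ, Tester.run_add, pow_succ]
    have hlen : ∀ t ∈ ((explorer H N (3 * L) R).run G (3 * L * k) []).support,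
        t.length = 3 * (L * k) := by
      intro t ht
      obtain ⟨u, rfl, hu⟩ := exists_of_mem_support_run H N _ R G
        (by rw [Nat.mul_assoc]; simp only [List.length_nil]; omega) ht
      exact hu.trans (Nat.mul_assoc _ _ _)
    refine toOuterMeasure_bind_le (ih (by omega)) (fun t ht _ => ?_) (fun t ht hf => ?_)
    · have := hlen t ht
      refine le_trans ?_ (tsub_le_tsub_left
        (hΦ.le_block hδ N R hL (t₀ := t) (by omega) (by omega)) 1)
      rw [← toOuterMeasure_add_compl _ {t | Found H R t}]
      refine (ENNReal.add_sub_cancel_left ?_).ge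
      refine ne_top_of_le_ne_top ENNReal.one_ne_top ?_
      rw [← toOuterMeasure_add_compl _ {t | Found H R t}]
      exact le_self_add
    -- A copy once found remains visible in every longer transcript.
    · rw [PMF.toOuterMeasure_apply_eq_zero_iff, Set.disjoint_compl_right_iff_subset]
      intro t' ht'
      have := hlen t ht
      obtain ⟨s, rfl, -⟩ := exists_of_mem_support_run H N _ R G (by omega) ht'
      exact (not_not.1 hf : Found H R t).append s

end Rejects

theorem exists_pow_le {c : ℝ≥0∞} (hc : c ≠ 0) : ∃ k : ℕ, (1 - c) ^ k ≤ 1 / 3 := by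
  have hlt : 1 - c < 1 := ENNReal.sub_lt_self ENNReal.one_ne_top one_ne_zero hc
  have h := ENNReal.tendsto_pow_atTop_nhds_zero_of_lt_one hlt
  have h3 : (0 : ℝ≥0∞) < 1 / 3 := by simp
  obtain ⟨k, hk⟩ := (h.eventually (gt_mem_nhds h3)).exists
  exact ⟨k, hk.le⟩

/-! ### Query bound, one-sided error and rejection probability of the explorer. -/

section Tester

variable {W : Type*} [Finite W] (H : SimpleGraph W) (N m R : ℕ) {n : ℕ} (G : SimpleGraph (Fin n))

open Classical in
theorem next_explorer_of_mem_support_law {t : Transcript}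
    (ht : t ∈ ((explorer H N m R).law G (3 * R)).support) :
    (explorer H N m R).next n t = .answer (!decide (N ≤ n ∧ Found H R t)) := by
  rw [Tester.law_eq_run] at ht
  obtain ⟨u, rfl, hu⟩ := exists_of_mem_support_run H N m R G (by simp) ht
  simp [explorer, explore, hu]

theorem haltsWithQueries_explorer : (explorer H N m R).HaltsWithQueries G (3 * R) := by
  refine ⟨3 * R, fun t ht => ⟨⟨_, next_explorer_of_mem_support_law H N m R G ht⟩, ?_⟩⟩
  rw [Tester.law_eq_run] at ht
  obtain ⟨u, rfl, hu⟩ := exists_of_mem_support_run H N m R G (by simp) ht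
  refine (Set.ncard_le_ncard (t := (Finset.range (3 * R) : Set ℕ)) ?_
    (Finset.finite_toSet _)).trans (by rw [Set.ncard_coe_finset, Finset.card_range])
  rintro i ⟨hi, -⟩
  simpa [hu] using hi

theorem probAnswer_true_explorer (h : ∀ t, IsSound G t → N ≤ n → ¬ Found H R t) :
    (explorer H N m R).probAnswer G true = 1 := by
  refine le_antisymm (iSup_le fun s => ?_) (le_iSup_of_le (3 * R) (le_of_eq (Eq.symm ?_)))
  · rw [← toOuterMeasure_add_compl ((explorer H N m R).law G s)]
    exact le_self_add
  · rw [PMF.toOuterMeasure_apply_eq_one_iff]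
    intro t ht
    have hs := isSound_of_mem_support_law H N m R G le_rfl ht
    simp only [Set.mem_ofPred_eq, next_explorer_of_mem_support_law H N m R G ht,
      Action.answer.injEq, Bool.not_eq_true', decide_eq_false_iff_not]
    exact fun hf => h t hs hf.1 hf.2

theorem le_probAnswer_false_explorer (hN : N ≤ n)
    (h : ((explorer H N m R).run G (3 * R) []).toOuterMeasure {t | Found H R t}ᶜ ≤ 1 / 3) :
    2 / 3 ≤ (explorer H N m R).probAnswer G false := by
  refine le_iSup_of_le (3 * R) ?_
  rw [← Tester.law_eq_run] at h
  have h1 : ((explorer H N m R).law G (3 * R)).toOuterMeasure {t | Found H R t} ≤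
      ((explorer H N m R).law G (3 * R)).toOuterMeasure
        {t | (explorer H N m R).next n t = .answer false} := by
    refine PMF.toOuterMeasure_mono _ fun t ht => ?_
    simp only [Set.mem_ofPred_eq, next_explorer_of_mem_support_law H N m R G ht.2,
      Action.answer.injEq, Bool.not_eq_false', decide_eq_true_eq]
    exact ⟨hN, ht.1⟩
  refine le_trans ?_ h1
  have h2 := toOuterMeasure_add_compl ((explorer H N m R).law G (3 * R)) {t | Found H R t}
  have h3 : (1 : ℝ≥0∞) = 2 / 3 + 1 / 3 := by
    rw [ENNReal.div_add_div_same, show (2 + 1 : ℝ≥0∞) = 3 by norm_num]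
    exact (ENNReal.div_self (by simp) (by simp)).symm
  refine ENNReal.le_of_add_le_add_right (a := 1 / 3) (by simp) ?_
  rw [← h3]
  exact h2.symm.le.trans (by gcongr)

end Tester

/-- If the graphs of `C` that are `ε`-far from `P` contain explorable families of copies
of `H`, then a tester that looks for copies of `H` works. -/
theorem exists_isOneSidedTester {W : Type*} [Finite W] (H : SimpleGraph W) (N : ℕ)
    {P C : GraphClass} {ε : ℝ} {δ : ℝ≥0∞} (h0 : δ ≠ 0) (h1 : δ ≤ 1)
    (hsound : ∀ (n : ℕ) (G : SimpleGraph (Fin n)), G ∈ P n → N ≤ n →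
      ∀ R t, IsSound G t → ¬ Found H R t)
    (hfar : ∀ (n : ℕ) (G : SimpleGraph (Fin n)), G ∈ C n → IsFar P ε G →
      N ≤ n ∧ ∃ Φ, IsExplorable H G δ Φ) :
    ∃ (q : ℕ) (T : Tester), IsOneSidedTester P C ε q T := by
  set L := Nat.card W ^ 2 + 1 with hL
  have hc : ((3 * L + 1 : ℝ≥0∞)⁻¹ * δ) ^ L ≠ 0 := by
    refine pow_ne_zero _ (mul_ne_zero (ENNReal.inv_ne_zero.2 ?_) h0)
    exact_mod_cast ENNReal.natCast_ne_top (3 * L + 1)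
  obtain ⟨k, hk⟩ := exists_pow_le hc
  refine ⟨3 * (L * k), explorer H N (3 * L) (L * k),
    fun n G _ => haltsWithQueries_explorer H N _ _ G, fun n G _ hP => ?_, fun n G hC hG => ?_⟩
  · exact probAnswer_true_explorer H N _ _ G fun t ht hN => hsound n G hP hN _ t ht
  · obtain ⟨hN, Φ, hΦ⟩ := hfar n G hC hG
    refine le_probAnswer_false_explorer H N _ _ G hN ?_
    have := hΦ.not_found_le h1 N (L * k) (L := L) (by omega) (k := k) le_rfl
    rw [Nat.mul_assoc] at this
    exact this.trans hk

/-! ### Packings of copies and colourful copies -/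

/-- The maps `φ` from the vertices of `H` to those of a graph with edge set `Y` that map edges to
edges and are colourful, i.e. the colour of `φ a` is `a`. -/
def colorCopies {V W : Type*} (H : SimpleGraph W) (χ : V → W) (Y : Finset (Sym2 V)) : Set (W → V) :=
  {φ | (∀ a, χ (φ a) = a) ∧ ∀ a b, H.Adj a b → s(φ a, φ b) ∈ Y}

section Packing

variable {V W : Type*} [Fintype V] [Fintype W]

open Classical in
-- Any colouring is recovered from its values on the image of `φ` and the colouring obtained by
-- recolouring that image correctly. Thus a random colouring makes `φ` colourful with probability at
-- least `|W| ^ (-|W|)`.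
theorem card_le_card_colorings {φ : W → V} (hφ : Function.Injective φ) :
    Fintype.card W ^ Fintype.card V ≤
      Fintype.card W ^ Fintype.card W *
        (Finset.univ.filter fun χ : V → W => ∀ a, χ (φ a) = a).card := by
  rw [← Fintype.card_subtype, ← Fintype.card_fun, ← Fintype.card_fun, ← Fintype.card_prod]
  refine Fintype.card_le_of_injective
    (fun χ => (χ ∘ φ, ⟨Function.extend φ id χ, fun a => hφ.extend_apply _ _ _⟩)) ?_
  intro χ χ' h
  simp only [Prod.mk.injEq, Subtype.mk.injEq] at h
  funext v
  by_cases hv : ∃ a, φ a = v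
  · obtain ⟨a, rfl⟩ := hv
    exact congrFun h.1 a
  · have := congrFun h.2 v
    rwa [Function.extend_apply' _ _ _ hv, Function.extend_apply' _ _ _ hv] at this

open Classical in
-- First moment: double counting pairs of a colouring and a member of `P` that it makes colourful.
theorem exists_coloring_of_injective [Nonempty W] (P : Finset (W → V))
    (hP : ∀ φ ∈ P, Function.Injective φ) :
    ∃ χ : V → W, P.card ≤ Fintype.card W ^ Fintype.card W *
      (P.filter fun φ => ∀ a, χ (φ a) = a).card := by
  by_contra! hcon
  have h1 : ∑ χ : V → W, Fintype.card W ^ Fintype.card W *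
      (P.filter fun φ => ∀ a, χ (φ a) = a).card < ∑ _χ : V → W, P.card :=
    Finset.sum_lt_sum_of_nonempty Finset.univ_nonempty fun χ _ => hcon χ
  have h2 : ∑ χ : V → W, (P.filter fun φ => ∀ a, χ (φ a) = a).card =
      ∑ φ ∈ P, (Finset.univ.filter fun χ : V → W => ∀ a, χ (φ a) = a).card := by
    simp only [Finset.card_filter]
    exact Finset.sum_comm
  rw [← Finset.mul_sum, h2, Finset.mul_sum, Finset.sum_const, Finset.card_univ, Fintype.card_fun,
    smul_eq_mul] at h1
  refine h1.not_ge ?_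
  calc Fintype.card W ^ Fintype.card V * P.card = ∑ _φ ∈ P, Fintype.card W ^ Fintype.card V := by
        rw [Finset.sum_const, smul_eq_mul, mul_comm]
    _ ≤ _ := Finset.sum_le_sum fun φ hφ => card_le_card_colorings (hP φ hφ)

open Classical in
/-- In a graph that is far from being `H`-free, the vertices can be coloured such that colourful
copies of `H` survive the deletion of few edges. -/
theorem exists_coloring_of_far (H : SimpleGraph W) (hH : H.edgeFinset.Nonempty)
    (G : SimpleGraph V) {x : ℝ}
    (hfar : ∀ G' : SimpleGraph V, H.Free G' →
      x < ((symmDiff G.edgeSet G'.edgeSet).ncard : ℝ)) :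
    ∃ χ : V → W, ∀ Y ⊆ G.edgeFinset,
      ((G.edgeFinset \ Y).card : ℝ) * (H.edgeFinset.card * Fintype.card W ^ Fintype.card W) ≤ x →
      (colorCopies H χ Y).Nonempty := by
  have : Nonempty W := by
    obtain ⟨e, -⟩ := hH
    induction e with | _ a b => exact ⟨a⟩
  let im : (W → V) → Finset (Sym2 V) := fun φ => H.edgeFinset.image (Sym2.map φ)
  let S : Set (Finset (W → V)) := {P | (∀ φ ∈ P, Function.Injective φ ∧ im φ ⊆ G.edgeFinset) ∧
    (P : Set (W → V)).PairwiseDisjoint im}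
  obtain ⟨P, hP⟩ := (Set.toFinite S).exists_maximal ⟨∅, by simp [S]⟩
  obtain ⟨hP1, hP2⟩ := hP.prop
  have him : ∀ φ, (im φ).Nonempty := fun φ => hH.image _
  -- a maximal packing is large
  have hcard : x < (P.card * H.edgeFinset.card : ℕ) := by
    set U := P.biUnion im
    have hfree : H.Free (G.deleteEdges U) := by
      rintro ⟨⟨f, hf⟩⟩
      have hf1 : ∀ e ∈ im f, e ∈ (G.deleteEdges (U : Set (Sym2 V))).edgeSet := by
        intro e he
        obtain ⟨e, he', rfl⟩ := Finset.mem_image.1 he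
        induction e with | _ a b =>
        have : H.Adj a b := by simpa using he'
        exact f.map_adj this
      have hdis : ∀ φ ∈ P, Disjoint (im φ) (im f) := by
        intro φ hφ
        rw [Finset.disjoint_right]
        intro e he hm
        have := hf1 e he
        rw [SimpleGraph.edgeSet_deleteEdges] at this
        exact this.2 (Finset.mem_coe.2 (Finset.mem_biUnion.2 ⟨φ, hφ, hm⟩))
      have hins : insert (f : W → V) P ∈ S := by
        refine ⟨fun φ hφ => ?_, ?_⟩
        · rcases Finset.mem_insert.1 hφ with rfl | hφ
          · refine ⟨hf, fun e he => ?_⟩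
            have := hf1 e he
            rw [SimpleGraph.edgeSet_deleteEdges] at this
            simpa using this.1
          · exact hP1 φ hφ
        · rw [Finset.coe_insert]
          exact hP2.insert fun φ hφ _ => (hdis φ hφ).symm
      have hmem : (f : W → V) ∈ P := hP.2 hins (Finset.subset_insert _ _) (Finset.mem_insert_self _ _)
      -- By maximality a surviving copy would belong to the packing, so its nonempty edge set would
      -- be disjoint from itself.
      exact (him f).ne_empty (Finset.disjoint_self_iff_empty _ |>.1 (hdis f hmem))
    refine (hfar _ hfree).trans_le ?_
    norm_cast
    have hsub : symmDiff G.edgeSet (G.deleteEdges (U : Set (Sym2 V))).edgeSet ⊆ (U : Set (Sym2 V)) := by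
      rw [SimpleGraph.edgeSet_deleteEdges]
      rintro e (⟨h1, h2⟩ | ⟨h1, h2⟩)
      · by_contra h
        exact h2 ⟨h1, h⟩
      · exact absurd h1.1 h2
    refine (Set.ncard_le_ncard hsub (Finset.finite_toSet _)).trans ?_
    rw [Set.ncard_coe_finset]
    refine Finset.card_biUnion_le_card_mul _ _ _ fun φ _ => Finset.card_image_le
  obtain ⟨χ, hχ⟩ := exists_coloring_of_injective P fun φ hφ => (hP1 φ hφ).1
  refine ⟨χ, fun Y hY hle => ?_⟩
  by_contra hempty
  -- every colourful copy of the packing loses an edge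
  have hloss : ∀ φ ∈ P.filter (fun φ => ∀ a, χ (φ a) = a), ∃ e ∈ im φ, e ∈ G.edgeFinset \ Y := by
    intro φ hφ
    obtain ⟨hφP, hφχ⟩ := Finset.mem_filter.1 hφ
    by_contra! hno
    refine hempty ⟨φ, hφχ, fun a b hab => ?_⟩
    have hm : s(φ a, φ b) ∈ im φ := Finset.mem_image.2 ⟨s(a, b), by simpa using hab, rfl⟩
    by_contra hY'
    exact hno _ hm (Finset.mem_sdiff.2 ⟨(hP1 φ hφP).2 hm, hY'⟩)
  have hle2 : (P.filter fun φ => ∀ a, χ (φ a) = a).card ≤ (G.edgeFinset \ Y).card := by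
    rcases (P.filter fun φ => ∀ a, χ (φ a) = a).eq_empty_or_nonempty with h | ⟨φ₀, hφ₀⟩
    · simp [h]
    have : Nonempty (Sym2 V) := ⟨(hloss φ₀ hφ₀).choose⟩
    choose! e he1 he2 using hloss
    refine Finset.card_le_card_of_injOn e (fun φ hφ => he2 φ hφ) fun φ hφ ψ hψ hφψ => ?_
    by_contra hne
    have := hP2 (Finset.mem_filter.1 hφ).1 (Finset.mem_filter.1 hψ).1 hne
    exact Finset.disjoint_left.1 this (he1 φ hφ) (hφψ ▸ he1 ψ hψ)
  have h3 : P.card * H.edgeFinset.card ≤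
      (G.edgeFinset \ Y).card * (H.edgeFinset.card * Fintype.card W ^ Fintype.card W) := by
    calc _ ≤ (Fintype.card W ^ Fintype.card W * (G.edgeFinset \ Y).card) * H.edgeFinset.card := by
          gcongr
          exact hχ.trans (by gcongr)
      _ = _ := by ring
  have h4 : ((P.card * H.edgeFinset.card : ℕ) : ℝ) ≤
      (G.edgeFinset \ Y).card * (H.edgeFinset.card * Fintype.card W ^ Fintype.card W) := by
    exact_mod_cast h3
  linarith

end Packing

/-! ### Cleaning up -/

/-- Successively deleting those sets `R i Y` that are smaller than their budget. -/
theorem exists_clean_subset {α ι : Type*} [DecidableEq α] [Fintype ι] (X : Finset α)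
    (R : ι → Finset α → Finset α) (hR : ∀ i Y, R i Y ⊆ Y)
    (hmono : ∀ i Y Z, Y ⊆ Z → R i Y ⊆ R i Z) (b : ι → ℝ) (hb : ∀ i, 0 ≤ b i) :
    ∃ Y ⊆ X, ((X \ Y).card : ℝ) ≤ ∑ i, b i ∧ ∀ i, R i Y = ∅ ∨ b i < (R i Y).card := by
  classical
  -- `J` is the set of indices already processed. By monotonicity their sets stay empty under later
  -- deletions, so each budget is spent at most once.
  let S : Set (Finset ι) := {J | ∃ Y ⊆ X, ((X \ Y).card : ℝ) ≤ ∑ i ∈ J, b i ∧ ∀ i ∈ J, R i Y = ∅}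
  obtain ⟨J, hJ⟩ := (Set.toFinite S).exists_maximal ⟨∅, X, subset_rfl, by simp, by simp⟩
  obtain ⟨Y, hYX, hcard, hempty⟩ := hJ.prop
  refine ⟨Y, hYX, hcard.trans (Finset.sum_le_univ_sum_of_nonneg hb), fun i => ?_⟩
  by_contra! hi
  have hiJ : i ∉ J := fun h => hi.1.ne_empty (hempty i h)
  refine hiJ (hJ.2 (y := insert i J) ⟨Y \ R i Y, Finset.sdiff_subset.trans hYX, ?_, ?_⟩
    (Finset.subset_insert _ _) (Finset.mem_insert_self _ _))
  · rw [Finset.sum_insert hiJ]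
    have h1 : X \ (Y \ R i Y) ⊆ R i Y ∪ (X \ Y) := by
      intro e
      simp only [Finset.mem_sdiff, Finset.mem_union]
      tauto
    have h2 : ((X \ (Y \ R i Y)).card : ℝ) ≤ (R i Y).card + (X \ Y).card := by
      exact_mod_cast (Finset.card_le_card h1).trans (Finset.card_union_le _ _)
    linarith [hi.2]
  · intro k hk
    rw [Finset.eq_empty_iff_forall_notMem]
    intro e he
    rcases Finset.mem_insert.1 hk with rfl | hk
    · exact (Finset.mem_sdiff.1 (hR _ _ he)).2 (hmono _ _ _ Finset.sdiff_subset he)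
    · have := hmono k _ _ Finset.sdiff_subset he
      rw [hempty k hk] at this
      simp at this

theorem colorCopies_mono {V W : Type*} (H : SimpleGraph W) (χ : V → W) {Y Z : Finset (Sym2 V)} (h : Y ⊆ Z) :
    colorCopies H χ Y ⊆ colorCopies H χ Z :=
  fun _ hφ => ⟨hφ.1, fun a b hab => h (hφ.2 a b hab)⟩

/-! ### Cleaning a graph with a tree order of bounded depth. -/

section TreeOrder

variable {V W : Type*} [Fintype V] [PartialOrder V] [Fintype W]

open Classical in
-- Each edge is charged to its larger end, which has at most `d` smaller vertices to be joined to.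
theorem sum_degree_le (G : SimpleGraph V) (hG : ∀ u v, G.Adj u v → u ≤ v ∨ v ≤ u) {d : ℕ}
    (hd : ∀ v : V, (Finset.univ.filter (· < v)).card ≤ d) :
    ∑ v, G.degree v ≤ 2 * (Fintype.card V * d) := by
  rw [G.sum_degrees_eq_twice_card_edges]
  gcongr
  have hsub : G.edgeFinset ⊆
      Finset.univ.biUnion fun v : V => (Finset.univ.filter (· < v)).image fun u => s(u, v) := by
    intro e he
    induction e with | _ a b =>
    have hab : G.Adj a b := by simpa using he
    simp only [Finset.mem_biUnion, Finset.mem_univ, true_and, Finset.mem_image, Finset.mem_filter]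
    rcases hG a b hab with h | h
    · exact ⟨b, a, lt_of_le_of_ne h hab.ne, rfl⟩
    · exact ⟨a, b, lt_of_le_of_ne h hab.ne', Sym2.eq_swap⟩
  refine (Finset.card_le_card hsub).trans ?_
  refine Finset.card_biUnion_le_card_mul _ _ _ fun v _ => Finset.card_image_le.trans (hd v)

open Classical in
/-- The edge set `Y` is clean: the lower end (i.e. the larger one) of every edge has degree at most
`D` in `G`, and whatever a colourful copy of `H` shows at a vertex is shown often. -/
structure IsClean (H : SimpleGraph W) (G : SimpleGraph V) (χ : V → W) (D δ : ℝ)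
    (Y : Finset (Sym2 V)) : Prop where
  subset : Y ⊆ G.edgeFinset
  degree_le : ∀ u v, s(u, v) ∈ Y → u < v → (G.degree v : ℝ) ≤ D
  root : ∀ φ ∈ colorCopies H χ Y, ∀ h, (G.degree (φ h) : ℝ) ≤ D →
    δ * Fintype.card V ≤
      (Finset.univ.filter fun w => ∃ φ' ∈ colorCopies H χ Y, φ' h = w).card
  down : ∀ φ ∈ colorCopies H χ Y, ∀ c c', H.Adj c c' →
    δ * G.degree (φ c) ≤ ((G.neighborFinset (φ c)).filter fun w =>
      ∃ φ' ∈ colorCopies H χ Y, (∀ a, φ a ≤ φ c → φ' a = φ a) ∧ φ' c' = w).card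

open Classical in
-- For each possible violation the edges witnessing it are deleted while they are within budget.
-- What survives exceeds its budget, and this excess gives the three properties. The budgets add up
-- to a small multiple of `n` because the degree sum is linear.
theorem exists_isClean (H : SimpleGraph W) (hH : ∀ a, ∃ b, H.Adj a b) (G : SimpleGraph V)
    (hG : ∀ u v, G.Adj u v → u ≤ v ∨ v ≤ u) {d : ℕ}
    (hd : ∀ v : V, (Finset.univ.filter (· < v)).card ≤ d) (χ : V → W) {D δ : ℝ} (hD : 0 < D)
    (hδ : 0 < δ) :
    ∃ Y, IsClean H G χ D δ Y ∧ ((G.edgeFinset \ Y).card : ℝ) ≤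
      (2 * d ^ 2 / D + (Fintype.card W * D + 2 * d *
        (Fintype.card W * (Fintype.card W * (d + 2) ^ Fintype.card W))) * δ) * Fintype.card V := by
  -- Three kinds of edges: from a vertex of degree above `D` to smaller ones; at the low-degree
  -- images of `h`; and those playing the role of `c c'` at `u`, given by `g` the positions of
  -- vertices of `H` at or below `u`.
  let R : V ⊕ W ⊕ (Σ u : V, W × W × (W → Option (Set.Iic u))) → Finset (Sym2 V) → Finset (Sym2 V)
    | .inl v, Y => Y.filter fun e => D < G.degree v ∧ ∃ u, u < v ∧ s(u, v) = e
    | .inr (.inl h), Y => Y.filter fun e =>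
        ∃ φ ∈ colorCopies H χ Y, (G.degree (φ h) : ℝ) ≤ D ∧ φ h ∈ e
    | .inr (.inr ⟨u, c, c', g⟩), Y => Y.filter fun e =>
        ∃ φ ∈ colorCopies H χ Y, φ c = u ∧ s(u, φ c') = e ∧ ∀ a y, g a = some y → φ a = y
  -- The first budget is at least `d` as soon as the degree exceeds `D`, so it always covers the at
  -- most `d` edges concerned. In the second, `D` accounts for the edges at each low-degree vertex.
  let b : V ⊕ W ⊕ (Σ u : V, W × W × (W → Option (Set.Iic u))) → ℝ
    | .inl v => d * G.degree v / D
    | .inr (.inl _) => δ * D * Fintype.card V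
    | .inr (.inr x) => δ * G.degree x.1
  have hR : ∀ i Y, R i Y ⊆ Y := by
    rintro (v | h | ⟨u, c, c', g⟩) Y <;> exact Finset.filter_subset _ _
  have hmono : ∀ i Y Z, Y ⊆ Z → R i Y ⊆ R i Z := by
    rintro (v | h | ⟨u, c, c', g⟩) Y Z hYZ e he <;>
      obtain ⟨heY, he⟩ := Finset.mem_filter.1 he
    · exact Finset.mem_filter.2 ⟨hYZ heY, he⟩
    · obtain ⟨φ, hφ, he⟩ := he
      exact Finset.mem_filter.2 ⟨hYZ heY, φ, colorCopies_mono H χ hYZ hφ, he⟩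
    · obtain ⟨φ, hφ, he⟩ := he
      exact Finset.mem_filter.2 ⟨hYZ heY, φ, colorCopies_mono H χ hYZ hφ, he⟩
  have hb : ∀ i, 0 ≤ b i := by
    rintro (v | h | x) <;> simp only [b] <;> positivity
  obtain ⟨Y, hYG, hcard, hY⟩ := exists_clean_subset G.edgeFinset R hR hmono b hb
  have hmem : ∀ {i e}, e ∈ R i Y → b i < (R i Y).card := fun {i e} he =>
    (hY i).resolve_left (Finset.ne_empty_of_mem he)
  have hadj : ∀ {x y}, s(x, y) ∈ Y → G.Adj x y := fun h => by simpa using hYG h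
  refine ⟨Y, ⟨hYG, ?_, ?_, ?_⟩, hcard.trans ?_⟩
  · intro u v huv hlt
    by_contra! hdeg
    have h1 := hmem (i := .inl v) (Finset.mem_filter.2 ⟨huv, hdeg, u, hlt, rfl⟩)
    have h2 : (R (.inl v) Y).card ≤ d := by
      refine le_trans ?_ (hd v)
      refine (Finset.card_le_card (t := (Finset.univ.filter (· < v)).image fun u => s(u, v))
        fun e he => ?_).trans Finset.card_image_le
      obtain ⟨-, -, u, hu, rfl⟩ := Finset.mem_filter.1 he
      exact Finset.mem_image.2 ⟨u, by simpa using hu, rfl⟩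
    have h3 : (d : ℝ) ≤ d * G.degree v / D := by
      rw [le_div_iff₀ hD]
      gcongr
    have h4 : ((R (.inl v) Y).card : ℝ) ≤ d := by exact_mod_cast h2
    simp only [b] at h1
    linarith
  · intro φ hφ h hdeg
    obtain ⟨a, ha⟩ := hH h
    have h1 := hmem (i := .inr (.inl h)) (e := s(φ h, φ a))
      (Finset.mem_filter.2 ⟨hφ.2 h a ha, φ, hφ, hdeg, by simp⟩)
    set B := Finset.univ.filter fun w => ∃ φ' ∈ colorCopies H χ Y, φ' h = w
    have h2 : (R (.inr (.inl h)) Y).card ≤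
        ∑ w ∈ B.filter fun w => (G.degree w : ℝ) ≤ D, G.degree w := by
      refine (Finset.card_le_card (t := (B.filter fun w => (G.degree w : ℝ) ≤ D).biUnion
        fun w => G.incidenceFinset w) fun e he => ?_).trans
        (Finset.card_biUnion_le.trans (Finset.sum_le_sum fun w _ => ?_))
      · obtain ⟨heY, φ', hφ', hle, hm⟩ := Finset.mem_filter.1 he
        refine Finset.mem_biUnion.2 ⟨φ' h, ?_, ?_⟩
        · exact Finset.mem_filter.2 ⟨Finset.mem_filter.2 ⟨Finset.mem_univ _, φ', hφ', rfl⟩, hle⟩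
        · rw [SimpleGraph.mem_incidenceFinset]
          exact ⟨by simpa using hYG heY, hm⟩
      · rw [G.card_incidenceFinset_eq_degree]
    have h3 : ((R (.inr (.inl h)) Y).card : ℝ) ≤ B.card * D := by
      calc ((R (.inr (.inl h)) Y).card : ℝ)
          ≤ ∑ w ∈ B.filter fun w => (G.degree w : ℝ) ≤ D, (G.degree w : ℝ) := by exact_mod_cast h2
        _ ≤ ∑ _w ∈ B.filter fun w => (G.degree w : ℝ) ≤ D, D :=
          Finset.sum_le_sum fun w hw => (Finset.mem_filter.1 hw).2
        _ ≤ B.card * D := by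
          rw [Finset.sum_const, nsmul_eq_mul]
          gcongr
          exact Finset.filter_subset _ _
    simp only [b] at h1
    refine le_of_mul_le_mul_right ?_ hD
    linarith
  · intro φ hφ c c' hcc'
    -- The full trace of `φ` on the elements at or below `φ c`; any copy compatible with it agrees
    -- with `φ` there.
    let g : W → Option (Set.Iic (φ c)) := fun a => if h : φ a ≤ φ c then some ⟨φ a, h⟩ else none
    have hg : ∀ a, (h : φ a ≤ φ c) → g a = some ⟨φ a, h⟩ := fun a h => dif_pos h
    have h1 := hmem (i := .inr (.inr ⟨φ c, c, c', g⟩)) (e := s(φ c, φ c'))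
      (Finset.mem_filter.2 ⟨hφ.2 c c' hcc', φ, hφ, rfl, rfl, fun a y hy => by
        by_cases h : φ a ≤ φ c
        · rw [hg a h] at hy
          rw [← Option.some.inj hy]
        · simp [g, h] at hy⟩)
    simp only [b] at h1
    refine h1.le.trans ?_
    norm_cast
    refine (Finset.card_le_card (t := Finset.image (fun w => s(φ c, w)) _) fun e he => ?_).trans
      Finset.card_image_le
    obtain ⟨heY, φ', hφ', hc, rfl, hφg⟩ := Finset.mem_filter.1 he
    refine Finset.mem_image.2 ⟨φ' c', Finset.mem_filter.2 ⟨?_, φ', hφ', ?_, rfl⟩, rfl⟩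
    · rw [SimpleGraph.mem_neighborFinset]
      exact hadj heY
    · exact fun a ha => hφg a _ (hg a ha)
  · have hdeg : ∑ v, (G.degree v : ℝ) ≤ 2 * (Fintype.card V * d) := by
      exact_mod_cast sum_degree_le G hG hd
    have hIic : ∀ u : V, Fintype.card (Set.Iic u) ≤ d + 1 := by
      intro u
      rw [← Set.toFinset_card]
      refine (Finset.card_le_card (t := insert u (Finset.univ.filter (· < u))) fun x hx => ?_).trans
        ((Finset.card_insert_le _ _).trans (by gcongr; exact hd u))
      simpa [le_iff_eq_or_lt] using hx
    -- The base `d + 2` counts at most `d + 1` elements of `Set.Iic u`, plus `none`. Only here does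
    -- bounded depth limit the number of traces.
    have hM : ∀ u : V, (Fintype.card (W × W × (W → Option (Set.Iic u))) : ℝ) ≤
        Fintype.card W * (Fintype.card W * (d + 2) ^ Fintype.card W) := by
      intro u
      rw [Fintype.card_prod, Fintype.card_prod, Fintype.card_fun, Fintype.card_option]
      push_cast
      have : (Fintype.card (Set.Iic u) : ℝ) + 1 ≤ d + 2 := by
        exact_mod_cast Nat.succ_le_succ (hIic u)
      have := pow_le_pow_left₀ (by positivity) this (Fintype.card W)
      gcongr
    rw [Fintype.sum_sum_type, Fintype.sum_sum_type, Fintype.sum_sigma]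
    simp only [b]
    rw [← Finset.sum_div, ← Finset.mul_sum]
    simp only [Finset.sum_const, Finset.card_univ, nsmul_eq_mul]
    have e1 : (d * ∑ v, (G.degree v : ℝ)) / D ≤ 2 * d ^ 2 / D * Fintype.card V := by
      have : (d : ℝ) * ∑ v, (G.degree v : ℝ) ≤ d * (2 * (Fintype.card V * d)) := by gcongr
      rw [div_mul_eq_mul_div]
      exact div_le_div_of_nonneg_right (by linarith) hD.le
    have e2 : ∑ u : V, ∑ _x : W × W × (W → Option (Set.Iic u)), δ * (G.degree u : ℝ) ≤
        (Fintype.card W * (Fintype.card W * (d + 2) ^ Fintype.card W)) *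
          (δ * (2 * (Fintype.card V * d))) := by
      calc _ ≤ ∑ u : V, (Fintype.card W * (Fintype.card W * (d + 2) ^ Fintype.card W) : ℝ) *
              (δ * G.degree u) := Finset.sum_le_sum fun u _ => by
              rw [Finset.sum_const, Finset.card_univ, nsmul_eq_mul]
              gcongr
              exact hM u
        _ = (Fintype.card W * (Fintype.card W * (d + 2) ^ Fintype.card W)) *
              (δ * ∑ v, (G.degree v : ℝ)) := by rw [← Finset.mul_sum, ← Finset.mul_sum]
        _ ≤ _ := by gcongr
    linarith

end TreeOrder

/-! ### Extending partially known copies -/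

section Extend

variable {V W : Type*} {H : SimpleGraph W} {χ : V → W} {Y : Finset (Sym2 V)}

theorem injective_of_mem_colorCopies {φ : W → V} (hφ : φ ∈ colorCopies H χ Y) :
    Function.Injective φ := fun a b h => by
  rw [← hφ.1 a, h, hφ.1 b]

open Classical in
/-- Two colourful copies can be glued along a set of vertices of `H`, provided they agree on the
outer boundary of the set. -/
theorem piecewise_mem_colorCopies {φ φ' : W → V} (hφ : φ ∈ colorCopies H χ Y)
    (hφ' : φ' ∈ colorCopies H χ Y) {C : Set W}
    (hC : ∀ a ∈ C, ∀ b ∉ C, H.Adj a b → φ' b = φ b) :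
    C.piecewise φ' φ ∈ colorCopies H χ Y := by
  refine ⟨fun a => ?_, fun a b hab => ?_⟩
  · by_cases ha : a ∈ C
    · rw [Set.piecewise_eq_of_mem _ _ _ ha, hφ'.1]
    · rw [Set.piecewise_eq_of_notMem _ _ _ ha, hφ.1]
  · by_cases ha : a ∈ C <;> by_cases hb : b ∈ C
    · rw [Set.piecewise_eq_of_mem _ _ _ ha, Set.piecewise_eq_of_mem _ _ _ hb]
      exact hφ'.2 a b hab
    · rw [Set.piecewise_eq_of_mem _ _ _ ha, Set.piecewise_eq_of_notMem _ _ _ hb, ← hC a ha b hb hab]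
      exact hφ'.2 a b hab
    · rw [Set.piecewise_eq_of_notMem _ _ _ ha, Set.piecewise_eq_of_mem _ _ _ hb,
        ← hC b hb a ha hab.symm]
      exact hφ'.2 a b hab
    · rw [Set.piecewise_eq_of_notMem _ _ _ ha, Set.piecewise_eq_of_notMem _ _ _ hb]
      exact hφ.2 a b hab

variable [Fintype V] [PartialOrder V] [Fintype W] {G : SimpleGraph V} {D δ : ℝ}

open Classical in
-- If all vertices are known, a missing edge is queried at its larger end, which has bounded degree.
-- If an edge of `H` leaves `K`, it is followed from the largest possible image. Otherwise an entire
-- component of `H` is unknown, and it is entered by a random draw at a vertex of bounded degree.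
theorem IsClean.extend (hY : IsClean H G χ D δ Y) (hH : ∀ a, ∃ b, H.Adj a b)
    (htree : ∀ u v w : V, u ≤ w → v ≤ w → u ≤ v ∨ v ≤ u)
    (hG : ∀ u v, G.Adj u v → u ≤ v ∨ v ≤ u) (hδ : 0 < δ) (hδD : δ * D ≤ 1)
    {φ : W → V} (hφ : φ ∈ colorCopies H χ Y) (K : Set W) (F : W → W → Prop)
    (hF : ∀ a b, F a b → F b a) :
    ((∀ a, a ∈ K) ∧ ∀ a b, H.Adj a b → F a b) ∨
    (∃ c ∉ K, ∃ B : Finset V, δ * Fintype.card V ≤ B.card ∧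
      ∀ w ∈ B, ∃ φ' ∈ colorCopies H χ Y, (∀ a ∈ K, φ' a = φ a) ∧ φ' c = w) ∨
    ∃ c ∈ K, ∃ c', H.Adj c c' ∧ (c' ∈ K → ¬ F c c') ∧
      ∃ A ⊆ G.neighborFinset (φ c), A.Nonempty ∧ δ * G.degree (φ c) ≤ A.card ∧
        ∀ w ∈ A, ∃ φ' ∈ colorCopies H χ Y, (∀ a ∈ K, φ' a = φ a) ∧ φ' c' = w := by
  have hadj : ∀ {a b}, H.Adj a b → G.Adj (φ a) (φ b) := fun h => by
    simpa using hY.subset (hφ.2 _ _ h)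
  have hlt : ∀ {a b}, H.Adj a b → φ a < φ b ∨ φ b < φ a := fun {a b} h =>
    (hG _ _ (hadj h)).imp (fun h' => h'.lt_of_ne (hadj h).ne) fun h' => h'.lt_of_ne (hadj h).ne'
  have hlow : ∀ {a b}, H.Adj a b → φ b < φ a → (G.degree (φ a) : ℝ) ≤ D := fun {a b} h h' =>
    hY.degree_le _ _ (Sym2.eq_swap ▸ hφ.2 a b h) h'
  -- the edges upwards are found since the degree of the lower end is small
  have hup : ∀ {a b}, H.Adj a b → φ b < φ a → ({φ b} : Finset V) ⊆ G.neighborFinset (φ a) ∧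
      ({φ b} : Finset V).Nonempty ∧ δ * G.degree (φ a) ≤ ({φ b} : Finset V).card ∧
      ∀ w ∈ ({φ b} : Finset V), ∃ φ' ∈ colorCopies H χ Y, (∀ a ∈ K, φ' a = φ a) ∧ φ' b = w := by
    intro a b h h'
    refine ⟨by simpa using hadj h, by simp, ?_, ?_⟩
    · rw [Finset.card_singleton, Nat.cast_one]
      exact le_trans (by gcongr; exact hlow h h') hδD
    · intro w hw
      exact ⟨φ, hφ, fun _ _ => rfl, (Finset.mem_singleton.1 hw).symm⟩
  by_cases hK : ∀ a, a ∈ K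
  · by_cases hF' : ∀ a b, H.Adj a b → F a b
    · exact .inl ⟨hK, hF'⟩
    push Not at hF'
    obtain ⟨a, b, hab, hnF⟩ := hF'
    refine .inr (.inr ?_)
    rcases hlt hab with h | h
    · exact ⟨b, hK b, a, hab.symm, fun _ h' => hnF (hF _ _ h'), _, hup hab.symm h⟩
    · exact ⟨a, hK a, b, hab, fun _ => hnF, _, hup hab h⟩
  push Not at hK
  obtain ⟨a₀, ha₀⟩ := hK
  refine .inr ?_
  by_cases hedge : {c | c ∈ K ∧ ∃ c' ∉ K, H.Adj c c'}.Nonempty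
  · refine .inr ?_
    -- Maximality of `φ c` among known vertices with an unknown neighbor keeps the part replaced
    -- below free of known vertices.
    obtain ⟨c, ⟨hcK, c', hc'K, hcc'⟩, hmax⟩ := Set.Finite.exists_maximalFor φ _ (Set.toFinite _) hedge
    refine ⟨c, hcK, c', hcc', fun h => absurd h hc'K, ?_⟩
    rcases hlt hcc' with hcc | hcc
    swap
    · exact ⟨_, hup hcc' hcc⟩
    refine ⟨_, Finset.filter_subset _ _, ⟨φ c', ?_⟩, hY.down φ hφ c c' hcc', fun w hw => ?_⟩
    · exact Finset.mem_filter.2 ⟨by simpa using hadj hcc', φ, hφ, fun _ _ => rfl, rfl⟩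
    obtain ⟨-, φ', hφ', hag, rfl⟩ := Finset.mem_filter.1 hw
    -- The component of `c'` after removal of the vertices with image at or below `φ c`. Its outer
    -- boundary consists of removed vertices, where `φ'` and `φ` agree.
    let C : Set W := {s | Relation.ReflTransGen (fun a b => H.Adj a b ∧ ¬ φ b ≤ φ c) c' s}
    have hCabove : ∀ s ∈ C, φ c < φ s := by
      intro s hs
      induction hs with
      | refl => exact hcc
      | @tail x y _ hxy ih =>
        rcases hlt hxy.1 with h | h
        · exact ih.trans h
        -- Two elements below a common one are comparable, so a path in `H` cannot leave the part
        -- above `φ c` without passing through an image at or below `φ c`.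
        · rcases htree _ _ _ ih.le h.le with h' | h'
          · exact h'.lt_of_not_ge hxy.2
          · exact absurd h' hxy.2
    have hCK : ∀ s ∈ C, s ∉ K := by
      intro s hs
      induction hs with
      | refl => exact hc'K
      | @tail x y hx hxy ih =>
        intro hyK
        have hy : y ∈ C := hx.tail hxy
        -- The first known vertex on a path from `c'` would have an unknown neighbor and an image
        -- strictly above `φ c`.
        exact hxy.2 (hmax ⟨hyK, x, ih, hxy.1.symm⟩ (hCabove y hy).le)
    refine ⟨C.piecewise φ' φ, piecewise_mem_colorCopies hφ hφ' fun a ha b hb hab => ?_,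
      fun a ha => ?_, ?_⟩
    · refine hag b ?_
      by_contra hle
      exact hb (Relation.ReflTransGen.tail ha ⟨hab, hle⟩)
    · exact Set.piecewise_eq_of_notMem _ _ _ fun h => hCK a h ha
    · exact Set.piecewise_eq_of_mem _ _ _ Relation.ReflTransGen.refl
  · refine .inl ?_
    let C : Set W := {s | Relation.ReflTransGen H.Adj a₀ s}
    have hCK : ∀ s ∈ C, s ∉ K := by
      intro s hs
      induction hs with
      | refl => exact ha₀
      | @tail x y _ hxy ih => exact fun hy => hedge ⟨y, hy, x, ih, hxy.symm⟩
    -- The component of `a₀` contains an edge because `H` has no isolated vertex, and the larger end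
    -- of its image has bounded degree.
    have hlowC : ∃ h ∈ C, (G.degree (φ h) : ℝ) ≤ D := by
      obtain ⟨b, hb⟩ := hH a₀
      rcases hlt hb with h | h
      · exact ⟨b, .single hb, hlow hb.symm h⟩
      · exact ⟨a₀, .refl, hlow hb h⟩
    obtain ⟨h, hhC, hdeg⟩ := hlowC
    refine ⟨h, hCK h hhC, _, hY.root φ hφ h hdeg, fun w hw => ?_⟩
    obtain ⟨-, φ', hφ', rfl⟩ := Finset.mem_filter.1 hw
    refine ⟨C.piecewise φ' φ, piecewise_mem_colorCopies hφ hφ' fun a ha b hb hab => ?_,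
      fun a ha => ?_, ?_⟩
    · exact absurd (Relation.ReflTransGen.tail ha hab) hb
    · exact Set.piecewise_eq_of_notMem _ _ _ fun h => hCK a h ha
    · exact Set.piecewise_eq_of_mem _ _ _ hhC

end Extend

/-- `D` is chosen first to make `a / D` small; `δ` is then chosen small depending on `D`. -/
theorem exists_constants {x : ℝ} (hx : 0 < x) {a b m : ℝ} (ha : 0 ≤ a) (hb : 0 ≤ b) (hm : 0 ≤ m) :
    ∃ D δ : ℝ, 0 < D ∧ 0 < δ ∧ δ ≤ 1 ∧ δ * D ≤ 1 ∧ a / D + (b * D + m) * δ ≤ x := by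
  obtain ⟨D, hD1, hD⟩ : ∃ D : ℝ, 1 ≤ D ∧ a / D ≤ x / 2 := by
    refine ⟨2 * a / x + 1, by linarith [show 0 ≤ 2 * a / x by positivity], ?_⟩
    rw [div_le_iff₀ (by positivity)]
    have : x / 2 * (2 * a / x + 1) = a + x / 2 := by field_simp
    linarith
  have hD0 : 0 < D := by linarith
  set y := b * D + m with hy
  have hy0 : 0 ≤ y := by positivity
  refine ⟨D, min (1 / D) (x / (2 * (y + 1))), hD0, by positivity, ?_, ?_, ?_⟩
  · exact (min_le_left _ _).trans ((div_le_one hD0).2 hD1)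
  · calc _ ≤ 1 / D * D := by gcongr; exact min_le_left _ _
      _ = 1 := by field_simp
  · have h1 : y * min (1 / D) (x / (2 * (y + 1))) ≤ (y + 1) * (x / (2 * (y + 1))) := by
      gcongr
      · linarith
      · exact min_le_right _ _
    have h2 : (y + 1) * (x / (2 * (y + 1))) = x / 2 := by field_simp
    linarith

theorem exists_isTreeEmbedding_of_treedepth_le {V : Type*} [Fintype V] {G : SimpleGraph V} {d : ℕ}
    (h : treedepth G ≤ d) :
    ∃ le : V → V → Prop, IsTreeEmbedding G le ∧ ∀ v, level le v ≤ d := by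
  -- The infimum of the empty set would be `0`, so it is attained only once some tree embedding is
  -- exhibited; any linear order is one.
  have hne : {k : ℕ | ∃ le : V → V → Prop, IsTreeEmbedding G le ∧ depth le = k}.Nonempty := by
    obtain ⟨e⟩ : Nonempty (V ≃ Fin (Fintype.card V)) := ⟨Fintype.equivFin V⟩
    refine ⟨_, fun u v => e u ≤ e v, ⟨⟨fun v => le_rfl, fun u v h1 h2 => ?_, fun u v w => le_trans,
      fun u v w _ _ => le_total _ _⟩, fun u v _ => le_total _ _⟩, rfl⟩
    exact e.injective (le_antisymm h1 h2)
  obtain ⟨le, hle, hdepth⟩ := Nat.sInf_mem hne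
  refine ⟨le, hle, fun v => (Finset.le_sup (f := level le) (Finset.mem_univ v)).trans ?_⟩
  exact hdepth.le.trans h

/-- Graphs of bounded treedepth that are far from being `H`-free have explorable families of copies
of `H`, if `H` has no isolated vertex. -/
theorem exists_isExplorable {W : Type*} [Finite W] (H : SimpleGraph W) (hH : ∀ a, ∃ b, H.Adj a b)
    (d : ℕ) {ε : ℝ} (hε : 0 < ε) :
    ∃ δ : ℝ≥0∞, δ ≠ 0 ∧ δ ≤ 1 ∧ ∀ (n : ℕ) (G : SimpleGraph (Fin n)), treedepth G ≤ d →
      IsFar (hFree H) ε G → ∃ Φ, IsExplorable H G δ Φ := by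
  classical
  cases nonempty_fintype W
  rcases isEmpty_or_nonempty W with hW | ⟨⟨a₀⟩⟩
  -- With nothing to discover, the empty map is already a completely known copy.
  · refine ⟨1, one_ne_zero, le_rfl, fun n G _ _ => ⟨Set.univ, ⟨isEmptyElim, Set.mem_univ _⟩,
      fun φ _ => Function.injective_of_subsingleton φ, fun φ _ K F _ => .inl ?_⟩⟩
    exact ⟨isEmptyElim, isEmptyElim⟩
  have hedge : H.edgeFinset.Nonempty := by
    obtain ⟨b, hb⟩ := hH a₀
    exact ⟨s(a₀, b), by simpa using hb⟩
  set m : ℝ := H.edgeFinset.card * Fintype.card W ^ Fintype.card W with hm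
  have hm0 : 0 < m := by
    have h1 := hedge.card_pos
    have h2 : 0 < Fintype.card W := Fintype.card_pos_iff.2 ⟨a₀⟩
    positivity
  obtain ⟨D, δ, hD, hδ, hδ1, hδD, hconst⟩ := exists_constants (x := ε / m) (by positivity)
    (a := 2 * d ^ 2) (b := Fintype.card W)
    (m := 2 * d * (Fintype.card W * (Fintype.card W * (d + 2) ^ Fintype.card W)))
    (by positivity) (by positivity) (by positivity)
  refine ⟨ENNReal.ofReal δ, by simpa using hδ, by simpa using hδ1, fun n G hG hfar => ?_⟩
  obtain ⟨le, ⟨⟨hrefl, hanti, htrans, htotal⟩, hcomp⟩, hlevel⟩ :=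
    exists_isTreeEmbedding_of_treedepth_le hG
  -- `Fin n` carries its usual order as an instance, so the tree order is passed explicitly below.
  let po : PartialOrder (Fin n) :=
    { le := le
      lt := fun u v => le u v ∧ ¬ le v u
      lt_iff_le_not_ge := fun _ _ => Iff.rfl
      le_refl := hrefl
      le_trans := htrans
      le_antisymm := hanti }
  have hd : ∀ v : Fin n, (Finset.univ.filter fun u => po.lt u v).card ≤ d := by
    intro v
    refine le_trans (le_of_eq ?_) (hlevel v)
    rw [level, ← Set.ncard_coe_finset]
    congr 1
    ext u
    simp only [Finset.coe_filter, Finset.mem_univ, true_and]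
    exact @lt_iff_le_and_ne _ po u v
  obtain ⟨χ, hχ⟩ := exists_coloring_of_far H hedge G (x := ε * n) fun G' hG' => hfar G' hG'
  obtain ⟨Y, hY, hcard⟩ := @exists_isClean _ _ _ po _ H hH G hcomp d (by convert hd) χ D δ hD hδ
  -- The constants were chosen so that cleaning deletes at most `ε / m * n` edges, just what the
  -- packing tolerates.
  obtain ⟨φ, hφ⟩ := hχ Y hY.subset <| by
    rw [← hm]
    calc _ ≤ (ε / m * n) * m := by
          gcongr
          refine hcard.trans ?_
          rw [Fintype.card_fin]
          gcongr
      _ = ε * n := by field_simp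
  have hcast : ∀ k l : ℕ, δ * k ≤ l → ENNReal.ofReal δ * k ≤ l := by
    intro k l h
    rw [← ENNReal.ofReal_natCast k, ← ENNReal.ofReal_natCast l, ← ENNReal.ofReal_mul hδ.le]
    exact ENNReal.ofReal_le_ofReal h
  refine ⟨colorCopies H χ Y, ⟨φ, hφ⟩, fun φ hφ => injective_of_mem_colorCopies hφ,
    fun φ hφ K F hF => ?_⟩
  rcases @IsClean.extend _ _ _ _ _ _ po _ _ _ _ hY hH htotal hcomp hδ hδD _ hφ K F hF with
    h | ⟨c, hc, B, hB, h⟩ | ⟨c, hc, c', h1, h2, A, hA, hne, hA', h⟩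
  · exact .inl h
  · rw [Fintype.card_fin] at hB
    exact .inr (.inl ⟨c, hc, B, hcast _ _ hB, h⟩)
  · exact .inr (.inr ⟨c, hc, c', h1, h2, A, by convert hA, hne, by convert hcast _ _ hA', h⟩)

/-! ### Isolated vertices -/

/-- The subgraph induced by the vertices that are not isolated. -/
abbrev dropIsolated {W : Type*} (H : SimpleGraph W) : SimpleGraph {a // ∃ b, H.Adj a b} :=
  H.comap Subtype.val

theorem exists_adj_dropIsolated {W : Type*} (H : SimpleGraph W) (a : {a // ∃ b, H.Adj a b}) :
    ∃ b, (dropIsolated H).Adj a b := by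
  obtain ⟨a, b, hab⟩ := a
  exact ⟨⟨b, a, hab.symm⟩, hab⟩

/-- Isolated vertices impose no edge condition, so any injective extension of `φ` works, and the
cardinality bound provides one. -/
theorem isContained_of_dropIsolated {V W : Type*} [Finite V] [Finite W] {H : SimpleGraph W}
    {G : SimpleGraph V} (hcard : Nat.card W ≤ Nat.card V) (φ : {a // ∃ b, H.Adj a b} → V)
    (hφ : Function.Injective φ) (hadj : ∀ a b, (dropIsolated H).Adj a b → G.Adj (φ a) (φ b)) :
    H.IsContained G := by
  classical
  cases nonempty_fintype V
  cases nonempty_fintype W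
  rw [Nat.card_eq_fintype_card, Nat.card_eq_fintype_card] at hcard
  obtain ⟨ψ, hψ, hext⟩ : ∃ ψ : W → V, Function.Injective ψ ∧ ∀ a, ψ a.1 = φ a := by
    rcases isEmpty_or_nonempty W with hW | hW
    · exact ⟨isEmptyElim, Function.injective_of_subsingleton _, fun a => isEmptyElim a.1⟩
    have : Nonempty V := Fintype.card_pos_iff.1 (Fintype.card_pos.trans_le hcard)
    obtain ⟨t, ht, -, htcard⟩ := Finset.exists_subsuperset_card_eq
      (Finset.subset_univ (Finset.univ.image φ))
      (Finset.card_image_le.trans (Fintype.card_subtype_le _)) hcard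
    have hval : ∀ a, Function.extend Subtype.val φ (fun _ => Classical.arbitrary V) a.1 = φ a :=
      fun a => Subtype.val_injective.extend_apply _ _ _
    obtain ⟨g, hg⟩ := Set.MapsTo.exists_equiv_extend_of_card_eq htcard.symm
      (s := {a | ∃ b, H.Adj a b})
      (f := Function.extend Subtype.val φ (fun _ => Classical.arbitrary V))
      (fun a ha => by
        rw [hval ⟨a, ha⟩]
        exact ht (Finset.mem_image_of_mem _ (Finset.mem_univ _)))
      (fun a ha b hb hab => by
        rw [hval ⟨a, ha⟩, hval ⟨b, hb⟩] at hab
        exact congrArg Subtype.val (hφ hab))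
    exact ⟨fun a => g a, Subtype.val_injective.comp g.injective,
      fun a => (hg a.1 a.2).trans (hval a)⟩
  refine ⟨⟨⟨ψ, fun {a b} hab => ?_⟩, hψ⟩⟩
  have := hadj ⟨a, b, hab⟩ ⟨b, a, hab.symm⟩ hab
  rwa [← hext, ← hext] at this

end GraphTesting

theorem mainTheorem2 {W : Type*} [Finite W] (H : SimpleGraph W) (C : GraphTesting.GraphClass)
    (hC : GraphTesting.HasBoundedTreedepth C) :
    GraphTesting.IsTestable (GraphTesting.hFree H) C := by
  classical
  intro ε hε
  obtain ⟨d, hd⟩ := hC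
  obtain ⟨δ, h0, h1, hδ⟩ := GraphTesting.exists_isExplorable (GraphTesting.dropIsolated H)
    (GraphTesting.exists_adj_dropIsolated H) d hε
  refine GraphTesting.exists_isOneSidedTester (GraphTesting.dropIsolated H) (Nat.card W) h0 h1
    (fun n G hG hn R t ht hf => ?_) fun n G hGC hfar => ⟨?_, hδ n G (hd n G hGC) ?_⟩
  · obtain ⟨φ, hφ, hadj⟩ := GraphTesting.exists_copy_of_found
      (GraphTesting.exists_adj_dropIsolated H) ht hf
    exact hG (GraphTesting.isContained_of_dropIsolated (by simpa using hn) φ hφ hadj)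
  -- A graph with fewer vertices than `H` is `H`-free, hence at distance zero from the property and
  -- not far.
  · by_contra! hn
    have hfree : G ∈ GraphTesting.hFree H n := by
      rintro ⟨f⟩
      have := Nat.card_le_card_of_injective f f.injective
      simp at this
      omega
    have := hfar G hfree
    simp only [symmDiff_self, Set.bot_eq_empty, Set.ncard_empty, Nat.cast_zero] at this
    have : 0 ≤ ε * n := by positivity
    linarith
  -- A graph without a copy of the smaller pattern is `H`-free, so being far from `H`-free implies
  -- being far from the stronger property.
  · intro G' hG'
    refine hfar G' fun hcon => hG' (SimpleGraph.IsContained.trans ⟨?_⟩ hcon)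
    exact ⟨⟨Subtype.val, fun h => h⟩, Subtype.val_injective⟩
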